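/- Let $n\ge 2$ and $m\ge 3$ be integers and let $K$ be a field containing a primitive $m$-th root of unity $q$. All algebras, Hopf algebras, Hopf algebra maps and tensor products are over $K$. Let $U_n(K)=\{\omega\in K : \omega^n=1\}$, let $K[C_n]$ be the group Hopf algebra of the cyclic group $C_n$ of order $n$, and let $T_{m^2}(q)$ be the Taft Hopf algebra, i.e. the algebra generated by $h,x$ subject to $h^m=1$, $x^m=0$, $xh=qhx$, with $$\Delta(h)=h\otimes h,\quad \Delta(x)=x\otimes h+1\otimes x,\quad \varepsilon(h)=1,\quad \varepsilon(x)=0,\quad S(h)=h^{-1},\quad S(x)=-xh^{-1}.$$ A Hopf algebra $E$ is said to factorize through Hopf algebras $A$ and $H$ if there are injective Hopf algebra maps $i\colon A\to E$ and $j\colon H\to E$ such that the linear map $A\otimes H\to E$, $a\otimes y\mapsto i(a)j(y)$, is bijective. For $\omega\in U_n(K)$ let $T^{\omega}_{nm^2}(q)$ be the Hopf algebra generated as an algebra by $g,h,x$ subject to the relations $$g^n=h^m=1,\quad x^m=0,\quad xh=qhx,\quad hg=gh,\quad gx=\omega xg,$$ with coalgebra structure and antipode given by $$\Delta(g)=g\otimes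 g,\quad \Delta(h)=h\otimes h,\quad \Delta(x)=x\otimes h+1\otimes x,\quad \varepsilon(g)=\varepsilon(h)=1,\quad \varepsilon(x)=0,$$ $$S(g)=g^{n-1},\quad S(h)=h^{m-1},\quad S(x)=-xh^{m-1}.$$ Then a Hopf algebra $E$ factorizes through $T_{m^2}(q)$ and $K[C_n]$ if and only if $E\cong T^{\omega}_{nm^2}(q)$ as Hopf algebras for some $\omega\in U_n(K)$. -/

import Mathlib

open scoped TensorProduct

noncomputable section

/-- A Hopf algebra `E` factorizes through the Hopf algebras `A` and `H` if there are injective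
Hopf algebra maps `i : A → E` and `j : H → E` such that the linear map
`A ⊗ H → E`, `a ⊗ y ↦ i a * j y`, is bijective. -/
def FactorizesThrough (K E A H : Type*) [Field K] [Ring E] [Ring A] [Ring H]
    [HopfAlgebra K E] [HopfAlgebra K A] [HopfAlgebra K H] : Prop :=
  ∃ (i : A →ₐc[K] E) (j : H →ₐc[K] E), Function.Injective i ∧ Function.Injective j ∧
    Function.Bijective
      (LinearMap.mul' K E ∘ₗ
        TensorProduct.map (i : A →ₐ[K] E).toLinearMap (j : H →ₐ[K] E).toLinearMap)

/-! ### Powers of sums of `q`-commuting elements -/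

namespace QBinomial

/-- Gaussian binomial coefficients, evaluated at `q`. -/
def coeff {K : Type*} [Field K] (q : K) : ℕ → ℕ → K
  | _, 0 => 1
  | 0, _ + 1 => 0
  | n + 1, k + 1 => coeff q n k + q ^ (k + 1) * coeff q n (k + 1)

variable {K : Type*} [Field K] (q : K)

lemma coeff_zero_right (n : ℕ) : coeff q n 0 = 1 := by cases n <;> rfl

lemma coeff_succ_succ (n k : ℕ) :
    coeff q (n + 1) (k + 1) = coeff q n k + q ^ (k + 1) * coeff q n (k + 1) := rfl

lemma coeff_eq_zero : ∀ {n k : ℕ}, n < k → coeff q n k = 0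
  | 0, _ + 1, _ => rfl
  | n + 1, k + 1, h => by
    rw [coeff_succ_succ, coeff_eq_zero (by omega), coeff_eq_zero (by omega)]; ring

lemma coeff_self : ∀ n : ℕ, coeff q n n = 1
  | 0 => rfl
  | n + 1 => by rw [coeff_succ_succ, coeff_self n, coeff_eq_zero q (by omega)]; ring

lemma pow_sub_one_mul_coeff : ∀ n k : ℕ,
    (q ^ (k + 1) - 1) * coeff q (n + 1) (k + 1) = (q ^ (n + 1) - 1) * coeff q n k
  | 0, 0 => by simp [coeff]
  | 0, k + 1 => by simp [coeff]
  | n + 1, 0 => by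
    have h := pow_sub_one_mul_coeff n 0
    rw [coeff_zero_right] at h
    rw [coeff_succ_succ, coeff_zero_right, mul_add, mul_left_comm, h]
    ring
  | n + 1, k + 1 => by
    have h₁ := pow_sub_one_mul_coeff n k
    have h₂ := pow_sub_one_mul_coeff n (k + 1)
    have h₃ := coeff_succ_succ q n k
    rw [coeff_succ_succ q (n + 1) (k + 1)]
    linear_combination q ^ (k + 2) * h₂ + q * h₁ - q * (q ^ (n + 1) - 1) * h₃

variable {A : Type*} [Ring A] [Algebra K A]

lemma mul_pow_of_qcomm {y z : A} (h : z * y = q • (y * z)) (k : ℕ) :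
    z * y ^ k = q ^ k • (y ^ k * z) := by
  induction k with
  | zero => simp
  | succ k ih =>
    rw [pow_succ, ← mul_assoc, ih, smul_mul_assoc, mul_assoc, h, mul_smul_comm, smul_smul,
      ← pow_succ, mul_assoc]

lemma mul_pow_eq_smul {y z : A} (h : z * y = q • (y * z)) (k : ℕ) :
    ∃ c : K, (y * z) ^ k = c • (y ^ k * z ^ k) := by
  induction k with
  | zero => exact ⟨1, by simp⟩
  | succ k ih =>
    obtain ⟨c, hc⟩ := ih
    refine ⟨q ^ k * c, ?_⟩
    rw [pow_succ', hc, mul_smul_comm, mul_assoc, ← mul_assoc z, mul_pow_of_qcomm q h,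
      smul_mul_assoc, mul_smul_comm, smul_smul, mul_comm c, mul_assoc (y ^ k), ← pow_succ',
      ← mul_assoc, ← pow_succ']

/-- If `b a = q a b` and `u` is the inverse of `a`, then `u b = q b u`. -/
lemma inv_qcomm {a b u : A} (h : b * a = q • (a * b)) (h₁ : a * u = 1) (h₂ : u * a = 1) :
    u * b = q • (b * u) := by
  calc u * b = u * (b * a) * u := by rw [mul_assoc, mul_assoc, h₁, mul_one]
    _ = q • (b * u) := by
      rw [h, mul_smul_comm, smul_mul_assoc, ← mul_assoc u, h₂, one_mul]

lemma add_pow_of_qcomm {y z : A} (h : z * y = q • (y * z)) (n : ℕ) :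
    (y + z) ^ n = ∑ k ∈ Finset.range (n + 1), coeff q n k • (y ^ k * z ^ (n - k)) := by
  induction n with
  | zero => simp [coeff]
  | succ n ih =>
    have h₁ : y * ∑ k ∈ Finset.range (n + 1), coeff q n k • (y ^ k * z ^ (n - k)) =
        ∑ k ∈ Finset.range (n + 1), coeff q n k • (y ^ (k + 1) * z ^ (n + 1 - (k + 1))) := by
      rw [Finset.mul_sum]
      refine Finset.sum_congr rfl fun k _ => ?_
      rw [mul_smul_comm, ← mul_assoc, ← pow_succ', Nat.add_sub_add_right]
    have h₂ : z * ∑ k ∈ Finset.range (n + 1), coeff q n k • (y ^ k * z ^ (n - k)) =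
        ∑ k ∈ Finset.range (n + 2), (q ^ k * coeff q n k) • (y ^ k * z ^ (n + 1 - k)) := by
      rw [Finset.sum_range_succ _ (n + 1), coeff_eq_zero q (Nat.lt_succ_self n), mul_zero,
        zero_smul, add_zero, Finset.mul_sum]
      refine Finset.sum_congr rfl fun k hk => ?_
      have hk' : n + 1 - k = (n - k) + 1 := by
        have := Finset.mem_range.1 hk
        omega
      rw [mul_smul_comm, ← mul_assoc, mul_pow_of_qcomm q h, smul_mul_assoc, smul_smul, mul_assoc,
        ← pow_succ', hk', mul_comm (q ^ k)]
    rw [pow_succ', ih, add_mul, h₁, h₂, Finset.sum_range_succ' _ (n + 1),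
      Finset.sum_range_succ' _ (n + 1), ← add_assoc, ← Finset.sum_add_distrib]
    simp only [coeff_succ_succ, add_smul, coeff_zero_right, pow_zero, mul_one]

lemma add_pow_of_isPrimitiveRoot {m : ℕ} (hm : 0 < m) (hq : IsPrimitiveRoot q m) {y z : A}
    (h : z * y = q • (y * z)) : (y + z) ^ m = y ^ m + z ^ m := by
  obtain ⟨m, rfl⟩ : ∃ l, m = l + 1 := ⟨m - 1, by omega⟩
  rw [add_pow_of_qcomm q h, Finset.sum_range_succ, Finset.sum_range_succ', Finset.sum_eq_zero]
  · simp [coeff_self, coeff_zero_right, add_comm]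
  · intro k hk
    have hk := Finset.mem_range.1 hk
    have h₁ := pow_sub_one_mul_coeff q m k
    rw [hq.pow_eq_one, sub_self, zero_mul] at h₁
    have h₂ : q ^ (k + 1) - 1 ≠ 0 :=
      sub_ne_zero.2 (hq.pow_ne_one_of_pos_of_lt (by omega) (by omega))
    rw [(mul_eq_zero.1 h₁).resolve_left h₂, zero_smul]

end QBinomial

/-! ### Antipodes given on algebra generators -/

section Antipode

variable {K A : Type*} [Field K] [Ring A] [Bialgebra K A]

/-- The linear endomorphism underlying an algebra map `A → Aᵐᵒᵖ`. -/
def antiLinear (S : A →ₐ[K] Aᵐᵒᵖ) : A →ₗ[K] A :=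
  (MulOpposite.opLinearEquiv K).symm.toLinearMap ∘ₗ S.toLinearMap

lemma antiLinear_apply (S : A →ₐ[K] Aᵐᵒᵖ) (a : A) : antiLinear S a = (S a).unop := rfl

lemma antiLinear_mul (S : A →ₐ[K] Aᵐᵒᵖ) (a b : A) :
    antiLinear S (a * b) = antiLinear S b * antiLinear S a := by
  simp [antiLinear_apply]

/-- A bialgebra with an algebra map `S : A → Aᵐᵒᵖ` that satisfies the antipode axioms on a set of
algebra generators is a Hopf algebra with antipode `S`. -/
@[reducible]
def hopfAlgebraOfAdjoin (S : A →ₐ[K] Aᵐᵒᵖ) (s : Set A) (hs : Algebra.adjoin K s = ⊤)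
    (hr : ∀ a ∈ s, LinearMap.mul' K A ((antiLinear S).rTensor A (Coalgebra.comul a)) =
      algebraMap K A (Coalgebra.counit a))
    (hl : ∀ a ∈ s, LinearMap.mul' K A ((antiLinear S).lTensor A (Coalgebra.comul a)) =
      algebraMap K A (Coalgebra.counit a)) : HopfAlgebra K A where
  antipode := antiLinear S
  mul_antipode_rTensor_comul := by
    ext a
    have ha : a ∈ Algebra.adjoin K s := hs ▸ Algebra.mem_top
    induction ha using Algebra.adjoin_induction with
    | mem a ha => exact hr a ha
    | algebraMap r => simp [Algebra.TensorProduct.algebraMap_apply, antiLinear_apply]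
    | add a b _ _ iha ihb =>
      simp only [map_add, iha, ihb]
    | mul a b _ _ iha ihb =>
      simp only [LinearMap.comp_apply, Algebra.linearMap_apply] at iha ihb ⊢
      have key : ∀ u v : A ⊗[K] A, ∀ c : K,
          LinearMap.mul' K A ((antiLinear S).rTensor A u) = algebraMap K A c →
          LinearMap.mul' K A ((antiLinear S).rTensor A (u * v)) =
            c • LinearMap.mul' K A ((antiLinear S).rTensor A v) := by
        intro u v c hu
        induction v using TensorProduct.induction_on with
        | zero => simp
        | add v w hv hw => simp only [mul_add, map_add, hv, hw, smul_add]
        | tmul p p' =>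
          have h : LinearMap.mul' K A ((antiLinear S).rTensor A (u * p ⊗ₜ[K] p')) =
              antiLinear S p * LinearMap.mul' K A ((antiLinear S).rTensor A u) * p' := by
            clear hu
            induction u using TensorProduct.induction_on with
            | zero => simp
            | add v w hv hw => simp only [mul_add, add_mul, map_add, hv, hw]
            | tmul r r' => simp [antiLinear_mul, mul_assoc]
          rw [h, hu, ← Algebra.commutes, mul_assoc, ← Algebra.smul_def]
          simp
      rw [Bialgebra.comul_mul, key _ _ _ iha, ihb, Bialgebra.counit_mul, map_mul,
        Algebra.smul_def]
  mul_antipode_lTensor_comul := by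
    ext a
    have ha : a ∈ Algebra.adjoin K s := hs ▸ Algebra.mem_top
    induction ha using Algebra.adjoin_induction with
    | mem a ha => exact hl a ha
    | algebraMap r => simp [Algebra.TensorProduct.algebraMap_apply, antiLinear_apply]
    | add a b _ _ iha ihb =>
      simp only [map_add, iha, ihb]
    | mul a b _ _ iha ihb =>
      simp only [LinearMap.comp_apply, Algebra.linearMap_apply] at iha ihb ⊢
      have key : ∀ u v : A ⊗[K] A, ∀ c : K,
          LinearMap.mul' K A ((antiLinear S).lTensor A v) = algebraMap K A c →
          LinearMap.mul' K A ((antiLinear S).lTensor A (u * v)) =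
            c • LinearMap.mul' K A ((antiLinear S).lTensor A u) := by
        intro u v c hv
        induction u using TensorProduct.induction_on with
        | zero => simp
        | add u w hu hw => simp only [add_mul, map_add, hu, hw, smul_add]
        | tmul p p' =>
          have h : LinearMap.mul' K A ((antiLinear S).lTensor A (p ⊗ₜ[K] p' * v)) =
              p * LinearMap.mul' K A ((antiLinear S).lTensor A v) * antiLinear S p' := by
            clear hv
            induction v using TensorProduct.induction_on with
            | zero => simp
            | add v w hv hw => simp only [mul_add, add_mul, map_add, hv, hw]
            | tmul r r' => simp [antiLinear_mul, mul_assoc]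
          rw [h, hv, ← Algebra.commutes, mul_assoc, ← Algebra.smul_def]
          simp
      rw [Bialgebra.comul_mul, key _ _ _ ihb, iha, Bialgebra.counit_mul, map_mul,
        Algebra.smul_def, Algebra.commutes]

end Antipode

/-! ### The Taft algebra -/

/-- Names of the generators of the Taft algebra. -/
inductive TaftGen
  | h
  | x

/-- The defining relations of the Taft algebra: `h ^ m = 1`, `x ^ m = 0`, `x h = q h x`. -/
inductive TaftRel {K : Type*} [Field K] (m : ℕ) (q : K) :
    FreeAlgebra K TaftGen → FreeAlgebra K TaftGen → Prop
  | h_pow : TaftRel m q (FreeAlgebra.ι K .h ^ m) 1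
  | x_pow : TaftRel m q (FreeAlgebra.ι K .x ^ m) 0
  | x_h : TaftRel m q (FreeAlgebra.ι K .x * FreeAlgebra.ι K .h)
      (q • (FreeAlgebra.ι K .h * FreeAlgebra.ι K .x))

/-- The Taft algebra `T_{m²}(q)`: the `K`-algebra generated by `h`, `x` subject to
`h ^ m = 1`, `x ^ m = 0`, `x h = q h x`. -/
def TaftAlgebra {K : Type*} [Field K] (m : ℕ) (q : K) : Type _ :=
  RingQuot (TaftRel m q)

namespace TaftAlgebra

variable {K : Type*} [Field K] (m : ℕ) (q : K)

instance : Ring (TaftAlgebra m q) := inferInstanceAs (Ring (RingQuot (TaftRel m q)))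

instance : Algebra K (TaftAlgebra m q) := inferInstanceAs (Algebra K (RingQuot (TaftRel m q)))

/-- The quotient map from the free algebra. -/
def mk : FreeAlgebra K TaftGen →ₐ[K] TaftAlgebra m q := RingQuot.mkAlgHom K (TaftRel m q)

/-- The generator `h`. -/
def h : TaftAlgebra m q := mk m q (FreeAlgebra.ι K .h)

/-- The generator `x`. -/
def x : TaftAlgebra m q := mk m q (FreeAlgebra.ι K .x)

lemma h_pow : h m q ^ m = 1 := by
  have := RingQuot.mkAlgHom_rel K (TaftRel.h_pow (m := m) (q := q))
  rwa [map_pow, map_one] at this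

lemma x_pow : x m q ^ m = 0 := by
  have := RingQuot.mkAlgHom_rel K (TaftRel.x_pow (m := m) (q := q))
  rwa [map_pow, map_zero] at this

lemma x_mul_h : x m q * h m q = q • (h m q * x m q) := by
  have := RingQuot.mkAlgHom_rel K (TaftRel.x_h (m := m) (q := q))
  rwa [map_mul, map_smul, map_mul] at this

variable {m q} in
/-- The universal property of the presentation. -/
def lift {B : Type*} [Ring B] [Algebra K B] (a b : B) (h₁ : a ^ m = 1) (h₂ : b ^ m = 0)
    (h₃ : b * a = q • (a * b)) : TaftAlgebra m q →ₐ[K] B :=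
  RingQuot.liftAlgHom K ⟨FreeAlgebra.lift K (fun | .h => a | .x => b), by
    rintro _ _ (_ | _ | _) <;> simp [h₁, h₂, h₃]⟩

section lift

variable {m q} {B : Type*} [Ring B] [Algebra K B] (a b : B) (h₁ : a ^ m = 1) (h₂ : b ^ m = 0)
    (h₃ : b * a = q • (a * b))

@[simp]
lemma lift_h : lift a b h₁ h₂ h₃ (h m q) = a :=
  (RingQuot.liftAlgHom_mkAlgHom_apply K _ _ _).trans (FreeAlgebra.lift_ι_apply _ _)

@[simp]
lemma lift_x : lift a b h₁ h₂ h₃ (x m q) = b :=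
  (RingQuot.liftAlgHom_mkAlgHom_apply K _ _ _).trans (FreeAlgebra.lift_ι_apply _ _)

end lift

lemma adjoin_eq_top : Algebra.adjoin K {h m q, x m q} = ⊤ := by
  have hs : Function.Surjective (mk m q) := RingQuot.mkAlgHom_surjective K (TaftRel m q)
  have hr : {h m q, x m q} = mk m q '' Set.range (FreeAlgebra.ι K) := by
    ext a
    constructor
    · rintro (rfl | rfl)
      exacts [⟨_, ⟨.h, rfl⟩, rfl⟩, ⟨_, ⟨.x, rfl⟩, rfl⟩]
    · rintro ⟨_, ⟨_ | _, rfl⟩, rfl⟩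
      exacts [Or.inl rfl, Or.inr rfl]
  rw [hr, ← AlgHom.map_adjoin, FreeAlgebra.adjoin_range_ι, Algebra.map_top,
    AlgHom.range_eq_top]
  exact hs

variable {m q} in
lemma algHom_ext {B : Type*} [Semiring B] [Algebra K B] {f f' : TaftAlgebra m q →ₐ[K] B}
    (hh : f (h m q) = f' (h m q)) (hx : f (x m q) = f' (x m q)) : f = f' :=
  AlgHom.ext_of_adjoin_eq_top (adjoin_eq_top m q) (by rintro _ (rfl | rfl) <;> assumption)

lemma h_mul_h_pow [NeZero m] : h m q * h m q ^ (m - 1) = 1 := by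
  rw [mul_pow_sub_one (NeZero.ne m), h_pow]

lemma h_pow_mul_h [NeZero m] : h m q ^ (m - 1) * h m q = 1 := by
  rw [pow_sub_one_mul (NeZero.ne m), h_pow]

variable [NeZero m] [hq : Fact (IsPrimitiveRoot q m)]

/-- `Δ(h) = h ⊗ h`, `Δ(x) = x ⊗ h + 1 ⊗ x`. -/
def comulHom : TaftAlgebra m q →ₐ[K] TaftAlgebra m q ⊗[K] TaftAlgebra m q :=
  lift (h m q ⊗ₜ h m q) (x m q ⊗ₜ h m q + 1 ⊗ₜ x m q)
    (by simp [Algebra.TensorProduct.tmul_pow, h_pow, Algebra.TensorProduct.one_def])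
    (by
      rw [QBinomial.add_pow_of_isPrimitiveRoot q (NeZero.pos m) hq.out]
      · simp [Algebra.TensorProduct.tmul_pow, x_pow]
      · simp [x_mul_h])
    (by simp [add_mul, mul_add, x_mul_h, TensorProduct.smul_tmul'])

/-- `ε(h) = 1`, `ε(x) = 0`. -/
def counitHom : TaftAlgebra m q →ₐ[K] K :=
  lift 1 0 (one_pow m) (zero_pow (NeZero.ne m)) (by simp)

instance : Bialgebra K (TaftAlgebra m q) :=
  .ofAlgHom (comulHom m q) (counitHom m q)
    (by
      apply algHom_ext <;>
        simp [comulHom, TensorProduct.add_tmul, TensorProduct.tmul_add, add_assoc,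
          Algebra.TensorProduct.one_def])
    (by apply algHom_ext <;> simp [comulHom, counitHom])
    (by apply algHom_ext <;> simp [comulHom, counitHom])

@[simp]
lemma comul_h : Coalgebra.comul (R := K) (h m q) = h m q ⊗ₜ h m q := lift_h _ _ _ _ _

@[simp]
lemma comul_x : Coalgebra.comul (R := K) (x m q) = x m q ⊗ₜ h m q + 1 ⊗ₜ x m q :=
  lift_x _ _ _ _ _

@[simp]
lemma counit_h : Coalgebra.counit (R := K) (h m q) = 1 := lift_h _ _ _ _ _

@[simp]
lemma counit_x : Coalgebra.counit (R := K) (x m q) = 0 := lift_x _ _ _ _ _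

/-- `S(h) = h ^ (m - 1)`, `S(x) = - x h ^ (m - 1)`, as an algebra map to the opposite algebra. -/
def antipodeHom : TaftAlgebra m q →ₐ[K] (TaftAlgebra m q)ᵐᵒᵖ :=
  lift (.op (h m q ^ (m - 1))) (.op (-(x m q * h m q ^ (m - 1))))
    (by rw [← MulOpposite.op_pow, ← pow_mul, mul_comm, pow_mul, h_pow, one_pow,
      MulOpposite.op_one])
    (by
      have hc := QBinomial.inv_qcomm q (x_mul_h m q) (h_mul_h_pow m q) (h_pow_mul_h m q)
      obtain ⟨c, h⟩ := QBinomial.mul_pow_eq_smul q hc m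
      rw [← MulOpposite.op_pow, neg_pow, h, x_pow, zero_mul, smul_zero, mul_zero,
        MulOpposite.op_zero])
    (by
      have hc := QBinomial.inv_qcomm q (x_mul_h m q) (h_mul_h_pow m q) (h_pow_mul_h m q)
      rw [← MulOpposite.op_mul, ← MulOpposite.op_mul, ← MulOpposite.op_smul, mul_neg,
        ← mul_assoc, hc, smul_mul_assoc, neg_mul, smul_neg])

instance : HopfAlgebra K (TaftAlgebra m q) :=
  hopfAlgebraOfAdjoin (antipodeHom m q) {h m q, x m q} (adjoin_eq_top m q)
    (by
      rintro _ (rfl | rfl) <;>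
        simp [antiLinear_apply, antipodeHom, h_pow_mul_h, mul_assoc])
    (by
      rintro _ (rfl | rfl) <;>
        simp [antiLinear_apply, antipodeHom, h_mul_h_pow])

lemma antipode_h : HopfAlgebra.antipode K (h m q) = h m q ^ (m - 1) :=
  congrArg MulOpposite.unop (lift_h _ _ _ _ _)

lemma antipode_x : HopfAlgebra.antipode K (x m q) = -(x m q * h m q ^ (m - 1)) :=
  congrArg MulOpposite.unop (lift_x _ _ _ _ _)

end TaftAlgebra

/-! ### The Hopf algebras `T^ω_{nm²}(q)` -/

/-- Names of the generators of `T^ω_{nm²}(q)`. -/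
inductive ExtTaftGen
  | g
  | h
  | x

/-- The defining relations of `T^ω_{nm²}(q)`: `g ^ n = 1`, `h ^ m = 1`, `x ^ m = 0`,
`x h = q h x`, `h g = g h`, `g x = ω x g`. -/
inductive ExtTaftRel {K : Type*} [Field K] (n m : ℕ) (q ω : K) :
    FreeAlgebra K ExtTaftGen → FreeAlgebra K ExtTaftGen → Prop
  | g_pow : ExtTaftRel n m q ω (FreeAlgebra.ι K .g ^ n) 1
  | h_pow : ExtTaftRel n m q ω (FreeAlgebra.ι K .h ^ m) 1
  | x_pow : ExtTaftRel n m q ω (FreeAlgebra.ι K .x ^ m) 0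
  | x_h : ExtTaftRel n m q ω (FreeAlgebra.ι K .x * FreeAlgebra.ι K .h)
      (q • (FreeAlgebra.ι K .h * FreeAlgebra.ι K .x))
  | h_g : ExtTaftRel n m q ω (FreeAlgebra.ι K .h * FreeAlgebra.ι K .g)
      (FreeAlgebra.ι K .g * FreeAlgebra.ι K .h)
  | g_x : ExtTaftRel n m q ω (FreeAlgebra.ι K .g * FreeAlgebra.ι K .x)
      (ω • (FreeAlgebra.ι K .x * FreeAlgebra.ι K .g))

/-- The algebra `T^ω_{nm²}(q)` generated by `g`, `h`, `x` subject to `g ^ n = 1`, `h ^ m = 1`,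
`x ^ m = 0`, `x h = q h x`, `h g = g h`, `g x = ω x g`. -/
def ExtTaftAlgebra {K : Type*} [Field K] (n m : ℕ) (q ω : K) : Type _ :=
  RingQuot (ExtTaftRel n m q ω)

namespace ExtTaftAlgebra

variable {K : Type*} [Field K] (n m : ℕ) (q ω : K)

instance : Ring (ExtTaftAlgebra n m q ω) := inferInstanceAs (Ring (RingQuot (ExtTaftRel n m q ω)))

instance : Algebra K (ExtTaftAlgebra n m q ω) :=
  inferInstanceAs (Algebra K (RingQuot (ExtTaftRel n m q ω)))

/-- The quotient map from the free algebra. -/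
def mk : FreeAlgebra K ExtTaftGen →ₐ[K] ExtTaftAlgebra n m q ω :=
  RingQuot.mkAlgHom K (ExtTaftRel n m q ω)

/-- The generator `g`. -/
def g : ExtTaftAlgebra n m q ω := mk n m q ω (FreeAlgebra.ι K .g)

/-- The generator `h`. -/
def h : ExtTaftAlgebra n m q ω := mk n m q ω (FreeAlgebra.ι K .h)

/-- The generator `x`. -/
def x : ExtTaftAlgebra n m q ω := mk n m q ω (FreeAlgebra.ι K .x)

lemma g_pow : g n m q ω ^ n = 1 := by
  have := RingQuot.mkAlgHom_rel K (ExtTaftRel.g_pow (n := n) (m := m) (q := q) (ω := ω))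
  rwa [map_pow, map_one] at this

lemma h_pow : h n m q ω ^ m = 1 := by
  have := RingQuot.mkAlgHom_rel K (ExtTaftRel.h_pow (n := n) (m := m) (q := q) (ω := ω))
  rwa [map_pow, map_one] at this

lemma x_pow : x n m q ω ^ m = 0 := by
  have := RingQuot.mkAlgHom_rel K (ExtTaftRel.x_pow (n := n) (m := m) (q := q) (ω := ω))
  rwa [map_pow, map_zero] at this

lemma x_mul_h : x n m q ω * h n m q ω = q • (h n m q ω * x n m q ω) := by
  have := RingQuot.mkAlgHom_rel K (ExtTaftRel.x_h (n := n) (m := m) (q := q) (ω := ω))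
  rwa [map_mul, map_smul, map_mul] at this

lemma h_mul_g : h n m q ω * g n m q ω = g n m q ω * h n m q ω := by
  have := RingQuot.mkAlgHom_rel K (ExtTaftRel.h_g (n := n) (m := m) (q := q) (ω := ω))
  rwa [map_mul, map_mul] at this

lemma g_mul_x : g n m q ω * x n m q ω = ω • (x n m q ω * g n m q ω) := by
  have := RingQuot.mkAlgHom_rel K (ExtTaftRel.g_x (n := n) (m := m) (q := q) (ω := ω))
  rwa [map_mul, map_smul, map_mul] at this

variable {n m q ω} in
/-- The universal property of the presentation. -/
def lift {B : Type*} [Ring B] [Algebra K B] (c a b : B) (h₀ : c ^ n = 1) (h₁ : a ^ m = 1)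
    (h₂ : b ^ m = 0) (h₃ : b * a = q • (a * b)) (h₄ : a * c = c * a)
    (h₅ : c * b = ω • (b * c)) : ExtTaftAlgebra n m q ω →ₐ[K] B :=
  RingQuot.liftAlgHom K ⟨FreeAlgebra.lift K (fun | .g => c | .h => a | .x => b), by
    rintro _ _ (_ | _ | _ | _ | _ | _) <;> simp [h₀, h₁, h₂, h₃, h₄, h₅]⟩

section lift

variable {n m q ω} {B : Type*} [Ring B] [Algebra K B] (c a b : B) (h₀ : c ^ n = 1)
    (h₁ : a ^ m = 1) (h₂ : b ^ m = 0) (h₃ : b * a = q • (a * b)) (h₄ : a * c = c * a)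
    (h₅ : c * b = ω • (b * c))

@[simp]
lemma lift_g : lift c a b h₀ h₁ h₂ h₃ h₄ h₅ (g n m q ω) = c :=
  (RingQuot.liftAlgHom_mkAlgHom_apply K _ _ _).trans (FreeAlgebra.lift_ι_apply _ _)

@[simp]
lemma lift_h : lift c a b h₀ h₁ h₂ h₃ h₄ h₅ (h n m q ω) = a :=
  (RingQuot.liftAlgHom_mkAlgHom_apply K _ _ _).trans (FreeAlgebra.lift_ι_apply _ _)

@[simp]
lemma lift_x : lift c a b h₀ h₁ h₂ h₃ h₄ h₅ (x n m q ω) = b :=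
  (RingQuot.liftAlgHom_mkAlgHom_apply K _ _ _).trans (FreeAlgebra.lift_ι_apply _ _)

end lift

lemma adjoin_eq_top : Algebra.adjoin K {g n m q ω, h n m q ω, x n m q ω} = ⊤ := by
  have hs : Function.Surjective (mk n m q ω) :=
    RingQuot.mkAlgHom_surjective K (ExtTaftRel n m q ω)
  have hr : {g n m q ω, h n m q ω, x n m q ω} =
      mk n m q ω '' Set.range (FreeAlgebra.ι K) := by
    ext a
    constructor
    · rintro (rfl | rfl | rfl)
      exacts [⟨_, ⟨.g, rfl⟩, rfl⟩, ⟨_, ⟨.h, rfl⟩, rfl⟩, ⟨_, ⟨.x, rfl⟩, rfl⟩]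
    · rintro ⟨_, ⟨_ | _ | _, rfl⟩, rfl⟩
      exacts [Or.inl rfl, Or.inr (Or.inl rfl), Or.inr (Or.inr rfl)]
  rw [hr, ← AlgHom.map_adjoin, FreeAlgebra.adjoin_range_ι, Algebra.map_top,
    AlgHom.range_eq_top]
  exact hs

variable {n m q ω} in
lemma algHom_ext {B : Type*} [Semiring B] [Algebra K B] {f f' : ExtTaftAlgebra n m q ω →ₐ[K] B}
    (hg : f (g n m q ω) = f' (g n m q ω)) (hh : f (h n m q ω) = f' (h n m q ω))
    (hx : f (x n m q ω) = f' (x n m q ω)) : f = f' :=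
  AlgHom.ext_of_adjoin_eq_top (adjoin_eq_top n m q ω)
    (by rintro _ (rfl | rfl | rfl) <;> assumption)

lemma h_mul_h_pow [NeZero m] : h n m q ω * h n m q ω ^ (m - 1) = 1 := by
  rw [mul_pow_sub_one (NeZero.ne m), h_pow]

lemma h_pow_mul_h [NeZero m] : h n m q ω ^ (m - 1) * h n m q ω = 1 := by
  rw [pow_sub_one_mul (NeZero.ne m), h_pow]

lemma g_mul_g_pow [NeZero n] : g n m q ω * g n m q ω ^ (n - 1) = 1 := by
  rw [mul_pow_sub_one (NeZero.ne n), g_pow]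

lemma g_pow_mul_g [NeZero n] : g n m q ω ^ (n - 1) * g n m q ω = 1 := by
  rw [pow_sub_one_mul (NeZero.ne n), g_pow]

lemma x_mul_g_pow [NeZero n] :
    x n m q ω * g n m q ω ^ (n - 1) = ω • (g n m q ω ^ (n - 1) * x n m q ω) := by
  calc x n m q ω * g n m q ω ^ (n - 1)
      = g n m q ω ^ (n - 1) * (g n m q ω * x n m q ω) * g n m q ω ^ (n - 1) := by
        rw [← mul_assoc, g_pow_mul_g, one_mul]
    _ = ω • (g n m q ω ^ (n - 1) * x n m q ω) := by
        rw [g_mul_x, mul_smul_comm, smul_mul_assoc, mul_assoc, mul_assoc, g_mul_g_pow, mul_one]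

lemma tmul_h_mul_g : (h n m q ω ⊗ₜ[K] h n m q ω) * (g n m q ω ⊗ₜ[K] g n m q ω) =
    (g n m q ω ⊗ₜ[K] g n m q ω) * (h n m q ω ⊗ₜ[K] h n m q ω) := by
  rw [Algebra.TensorProduct.tmul_mul_tmul, Algebra.TensorProduct.tmul_mul_tmul, h_mul_g]

variable [NeZero m] [hq : Fact (IsPrimitiveRoot q m)]

/-- `Δ(g) = g ⊗ g`, `Δ(h) = h ⊗ h`, `Δ(x) = x ⊗ h + 1 ⊗ x`. -/
def comulHom :
    ExtTaftAlgebra n m q ω →ₐ[K] ExtTaftAlgebra n m q ω ⊗[K] ExtTaftAlgebra n m q ω :=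
  lift (g n m q ω ⊗ₜ g n m q ω) (h n m q ω ⊗ₜ h n m q ω)
    (x n m q ω ⊗ₜ h n m q ω + 1 ⊗ₜ x n m q ω)
    (by simp [Algebra.TensorProduct.tmul_pow, g_pow, Algebra.TensorProduct.one_def])
    (by simp [Algebra.TensorProduct.tmul_pow, h_pow, Algebra.TensorProduct.one_def])
    (by
      rw [QBinomial.add_pow_of_isPrimitiveRoot q (NeZero.pos m) hq.out]
      · simp [Algebra.TensorProduct.tmul_pow, x_pow]
      · simp [x_mul_h])
    (by simp [add_mul, mul_add, x_mul_h, TensorProduct.smul_tmul'])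
    (tmul_h_mul_g n m q ω)
    (by simp [add_mul, mul_add, g_mul_x, h_mul_g, TensorProduct.smul_tmul'])

/-- `ε(g) = 1`, `ε(h) = 1`, `ε(x) = 0`. -/
def counitHom : ExtTaftAlgebra n m q ω →ₐ[K] K :=
  lift 1 1 0 (one_pow n) (one_pow m) (zero_pow (NeZero.ne m)) (by simp) rfl (by simp)

instance : Bialgebra K (ExtTaftAlgebra n m q ω) :=
  .ofAlgHom (comulHom n m q ω) (counitHom n m q ω)
    (by
      apply algHom_ext <;>
        simp [comulHom, TensorProduct.add_tmul, TensorProduct.tmul_add, add_assoc,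
          Algebra.TensorProduct.one_def])
    (by apply algHom_ext <;> simp [comulHom, counitHom])
    (by apply algHom_ext <;> simp [comulHom, counitHom])

@[simp]
lemma comul_g : Coalgebra.comul (R := K) (g n m q ω) = g n m q ω ⊗ₜ g n m q ω :=
  lift_g _ _ _ _ _ _ _ _ _

@[simp]
lemma comul_h : Coalgebra.comul (R := K) (h n m q ω) = h n m q ω ⊗ₜ h n m q ω :=
  lift_h _ _ _ _ _ _ _ _ _

@[simp]
lemma comul_x :
    Coalgebra.comul (R := K) (x n m q ω) = x n m q ω ⊗ₜ h n m q ω + 1 ⊗ₜ x n m q ω :=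
  lift_x _ _ _ _ _ _ _ _ _

@[simp]
lemma counit_g : Coalgebra.counit (R := K) (g n m q ω) = 1 := lift_g _ _ _ _ _ _ _ _ _

@[simp]
lemma counit_h : Coalgebra.counit (R := K) (h n m q ω) = 1 := lift_h _ _ _ _ _ _ _ _ _

@[simp]
lemma counit_x : Coalgebra.counit (R := K) (x n m q ω) = 0 := lift_x _ _ _ _ _ _ _ _ _

variable [NeZero n]

/-- `S(g) = g ^ (n - 1)`, `S(h) = h ^ (m - 1)`, `S(x) = - x h ^ (m - 1)`, as an algebra map to the
opposite algebra. -/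
def antipodeHom : ExtTaftAlgebra n m q ω →ₐ[K] (ExtTaftAlgebra n m q ω)ᵐᵒᵖ :=
  lift (.op (g n m q ω ^ (n - 1))) (.op (h n m q ω ^ (m - 1)))
    (.op (-(x n m q ω * h n m q ω ^ (m - 1))))
    (by rw [← MulOpposite.op_pow, ← pow_mul, mul_comm, pow_mul, g_pow, one_pow,
      MulOpposite.op_one])
    (by rw [← MulOpposite.op_pow, ← pow_mul, mul_comm, pow_mul, h_pow, one_pow,
      MulOpposite.op_one])
    (by
      have hc := QBinomial.inv_qcomm q (x_mul_h n m q ω) (h_mul_h_pow n m q ω)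
        (h_pow_mul_h n m q ω)
      obtain ⟨c, h⟩ := QBinomial.mul_pow_eq_smul q hc m
      rw [← MulOpposite.op_pow, neg_pow, h, x_pow, zero_mul, smul_zero, mul_zero,
        MulOpposite.op_zero])
    (by
      have hc := QBinomial.inv_qcomm q (x_mul_h n m q ω) (h_mul_h_pow n m q ω)
        (h_pow_mul_h n m q ω)
      rw [← MulOpposite.op_mul, ← MulOpposite.op_mul, ← MulOpposite.op_smul, mul_neg,
        ← mul_assoc, hc, smul_mul_assoc, neg_mul, smul_neg])
    (by
      have hc : Commute (h n m q ω) (g n m q ω) := h_mul_g n m q ω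
      rw [← MulOpposite.op_mul, ← MulOpposite.op_mul, (hc.pow_pow (m - 1) (n - 1)).eq])
    (by
      have hc : Commute (h n m q ω) (g n m q ω) := h_mul_g n m q ω
      rw [← MulOpposite.op_mul, ← MulOpposite.op_mul, ← MulOpposite.op_smul, neg_mul, mul_assoc,
        (hc.pow_pow (m - 1) (n - 1)).eq, ← mul_assoc, x_mul_g_pow, mul_neg, smul_neg,
        smul_mul_assoc, mul_assoc])

instance : HopfAlgebra K (ExtTaftAlgebra n m q ω) :=
  hopfAlgebraOfAdjoin (antipodeHom n m q ω) {g n m q ω, h n m q ω, x n m q ω}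
    (adjoin_eq_top n m q ω)
    (by
      rintro _ (rfl | rfl | rfl) <;>
        simp [antiLinear_apply, antipodeHom, h_pow_mul_h, g_pow_mul_g, mul_assoc])
    (by
      rintro _ (rfl | rfl | rfl) <;>
        simp [antiLinear_apply, antipodeHom, h_mul_h_pow, g_mul_g_pow])

lemma antipode_g : HopfAlgebra.antipode K (g n m q ω) = g n m q ω ^ (n - 1) :=
  congrArg MulOpposite.unop (lift_g _ _ _ _ _ _ _ _ _)

lemma antipode_h : HopfAlgebra.antipode K (h n m q ω) = h n m q ω ^ (m - 1) :=
  congrArg MulOpposite.unop (lift_h _ _ _ _ _ _ _ _ _)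

lemma antipode_x :
    HopfAlgebra.antipode K (x n m q ω) = -(x n m q ω * h n m q ω ^ (m - 1)) :=
  congrArg MulOpposite.unop (lift_x _ _ _ _ _ _ _ _ _)

end ExtTaftAlgebra

end

/-! Write `A` for the Taft algebra. In `T^ω` the generator `g` can be moved to the right past `h`
and `x`, so the product map from `A ⊗ K[C_n]` is onto. It is injective because `T^ω` acts on `A ⊗
K[C_n]` in such a way that the product of `t` and `y` sends `1 ⊗ 1` to `t ⊗ y`
(`factorMap_bijective`).

Conversely, let `E` factorize through injections `i` and `j`, and let `G`, `H`, `X` be the images of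
`g`, `h`, `x`. As a coalgebra, `E` is the direct sum of the pieces `i(A) G^k`. The element `G X` is
skew primitive between the group-likes `G` and `G H`. Projecting to the piece `i(A) G` leaves two
cases (`eq_smul_or_exists`): either `G X` is a multiple of `G - G H`, which is absurd because `x` is
not a multiple of `1 - h`, or both `G H` and `G X` lie in `i(A) G`. Hence conjugation by `G` carries
`h` and `x` to elements `t`, `s` of `A` with `t` group-like, `s` skew primitive and `s t = q t s`.

The skew derivation of `A` dual to `x` has kernel `K[h]`. This forces `t = h` and `s = ω x`
(`eq_h_and_eq_smul_x`); the `q`-commutation rules out a contribution from `1 - h`. The equation `G^n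
= 1` gives `ω^n = 1`. The presentation of `T^ω` then provides a map to `E` that matches the two
product maps, hence an isomorphism (`nonempty_equiv`). -/

noncomputable section

/-! ### Slicing the comultiplication with a functional -/

namespace Coalgebra

variable {K C : Type*} [CommSemiring K] [AddCommMonoid C] [Module K C] [Coalgebra K C]

/-- The map `c ↦ ∑ f(c₂) c₁`. -/
def sliceRight (f : C →ₗ[K] K) : C →ₗ[K] C :=
  (_root_.TensorProduct.rid K C).toLinearMap ∘ₗ f.lTensor C ∘ₗ comul

/-- The map `c ↦ ∑ f(c₁) c₂`. -/
def sliceLeft (f : C →ₗ[K] K) : C →ₗ[K] C :=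
  (_root_.TensorProduct.lid K C).toLinearMap ∘ₗ f.rTensor C ∘ₗ comul

lemma sliceRight_apply (f : C →ₗ[K] K) (c : C) :
    sliceRight f c = _root_.TensorProduct.rid K C (f.lTensor C (comul c)) := rfl

lemma sliceLeft_apply (f : C →ₗ[K] K) (c : C) :
    sliceLeft f c = _root_.TensorProduct.lid K C (f.rTensor C (comul c)) := rfl

lemma sliceRight_of_comul_eq_tmul_self (f : C →ₗ[K] K) {c : C}
    (hc : comul (R := K) c = c ⊗ₜ c) : sliceRight f c = f c • c := by
  simp [sliceRight_apply, hc]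

lemma sliceLeft_of_comul_eq_tmul_self (f : C →ₗ[K] K) {c : C}
    (hc : comul (R := K) c = c ⊗ₜ c) : sliceLeft f c = f c • c := by
  simp [sliceLeft_apply, hc]

lemma sliceRight_of_skewPrimitive (f : C →ₗ[K] K) {c u v : C}
    (hc : comul (R := K) c = c ⊗ₜ u + v ⊗ₜ c) :
    sliceRight f c = f u • c + f c • v := by
  simp [sliceRight_apply, hc]

lemma sliceLeft_of_skewPrimitive (f : C →ₗ[K] K) {c u v : C}
    (hc : comul (R := K) c = c ⊗ₜ u + v ⊗ₜ c) :
    sliceLeft f c = f c • u + f v • c := by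
  simp [sliceLeft_apply, hc]

end Coalgebra

/-- A subspace that contains `1` and is stable under left multiplication by algebra generators is
everything. -/
lemma Submodule.eq_top_of_adjoin_eq_top {K A : Type*} [Field K] [Ring A] [Algebra K A]
    {s : Set A} (hs : Algebra.adjoin K s = ⊤) (M : Submodule K A) (h₁ : 1 ∈ M)
    (hM : ∀ a ∈ s, ∀ y ∈ M, a * y ∈ M) : M = ⊤ := by
  have key : ∀ a : A, ∀ y ∈ M, a * y ∈ M := by
    intro a
    have ha : a ∈ Algebra.adjoin K s := hs ▸ Algebra.mem_top
    induction ha using Algebra.adjoin_induction with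
    | mem a ha => exact hM a ha
    | algebraMap r => intro y hy; rw [← Algebra.smul_def]; exact M.smul_mem r hy
    | add a b _ _ iha ihb => intro y hy; rw [add_mul]; exact M.add_mem (iha y hy) (ihb y hy)
    | mul a b _ _ iha ihb => intro y hy; rw [mul_assoc]; exact iha _ (ihb y hy)
  rw [eq_top_iff]
  intro a _
  simpa using key a 1 h₁

namespace TaftAlgebra

open Coalgebra Polynomial

variable {K : Type*} [Field K] (m : ℕ) (q : K)

/-! ### A spanning family of the Taft algebra -/

/-- Coefficients are kept as polynomials in `h` on the left. Passing `x` across one only rescales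
its variable, so the normal form is preserved. -/
lemma x_mul_aeval_h (p : K[X]) :
    x m q * aeval (h m q) p = aeval (h m q) (p.comp (C q * X)) * x m q := by
  induction p using Polynomial.induction_on' with
  | add p r hp hr => simp only [map_add, mul_add, add_mul, hp, hr, add_comp]
  | monomial k a =>
    simp only [aeval_monomial, monomial_comp, map_mul, map_pow, aeval_C, aeval_X]
    rw [← Algebra.smul_def, mul_smul_comm, QBinomial.mul_pow_of_qcomm q (x_mul_h m q),
      ← Algebra.smul_def, ← Algebra.smul_def, _root_.smul_pow, smul_mul_assoc, smul_mul_assoc]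

/-- The subspace of the Taft algebra spanned by the `h ^ a * x ^ b` with `b < k`. -/
def filtration (k : ℕ) : Submodule K (TaftAlgebra m q) :=
  LinearMap.range (∑ b : Fin k, (LinearMap.mulRight K (x m q ^ (b : ℕ))) ∘ₗ
    (aeval (h m q)).toLinearMap ∘ₗ (LinearMap.proj b : (Fin k → K[X]) →ₗ[K] K[X]))

lemma mem_filtration {k : ℕ} {t : TaftAlgebra m q} : t ∈ filtration m q k ↔
    ∃ p : Fin k → K[X], ∑ b, aeval (h m q) (p b) * x m q ^ (b : ℕ) = t := by
  simp [filtration]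

lemma aeval_mul_pow_mem_filtration {k b : ℕ} (hb : b < k) (p : K[X]) :
    aeval (h m q) p * x m q ^ b ∈ filtration m q k := by
  classical
  rw [mem_filtration]
  refine ⟨Pi.single ⟨b, hb⟩ p, ?_⟩
  rw [Finset.sum_eq_single ⟨b, hb⟩] <;> simp +contextual

/-- Only spanning is proved. Linear independence of the monomials is never needed, because the skew
derivation below detects the coefficients. -/
lemma filtration_eq_top [NeZero m] : filtration m q m = ⊤ := by
  refine Submodule.eq_top_of_adjoin_eq_top (adjoin_eq_top m q) _ ?_ ?_
  · simpa using aeval_mul_pow_mem_filtration m q (NeZero.pos m) (1 : K[X])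
  · intro a ha y hy
    obtain ⟨p, rfl⟩ := (mem_filtration m q).1 hy
    rw [Finset.mul_sum]
    refine Submodule.sum_mem _ fun b _ => ?_
    obtain rfl | rfl := ha
    · rw [← mul_assoc]
      have := aeval_mul_pow_mem_filtration m q b.2 (X * p b)
      rwa [map_mul, aeval_X] at this
    · rw [← mul_assoc, x_mul_aeval_h, mul_assoc, ← pow_succ']
      obtain hb | hb := (Nat.succ_le_of_lt b.2).lt_or_eq
      · exact aeval_mul_pow_mem_filtration m q hb _
      · rw [show (b : ℕ) + 1 = m from hb, x_pow, mul_zero]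
        exact Submodule.zero_mem _

/-! ### The skew derivation dual to `x` -/

variable [hq : Fact (IsPrimitiveRoot q m)]

lemma geom_sum_ne_zero {b : ℕ} (hb : b + 1 < m) : ∑ i ∈ Finset.range (b + 1), q ^ i ≠ 0 := by
  intro h0
  have h1 := geom_sum_mul q (b + 1)
  rw [h0, zero_mul] at h1
  exact hq.out.pow_ne_one_of_pos_of_lt (by omega) hb (sub_eq_zero.1 h1.symm)

/-- The two-dimensional representation `h ↦ diag(1, q)`, `x ↦ E₁₂`. -/
def matrixRep (hm : 2 ≤ m) : TaftAlgebra m q →ₐ[K] Matrix (Fin 2) (Fin 2) K :=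
  lift (Matrix.diagonal ![1, q]) !![0, 1; 0, 0]
    (by
      rw [Matrix.diagonal_pow, ← Matrix.diagonal_one]
      congr 1
      ext i
      fin_cases i <;> simp [hq.out.pow_eq_one])
    (by
      have h2 : (!![0, 1; 0, 0] : Matrix (Fin 2) (Fin 2) K) ^ 2 = 0 := by
        ext i j; fin_cases i <;> fin_cases j <;> simp [sq]
      exact pow_eq_zero_of_le hm h2)
    (by ext i j; fin_cases i <;> fin_cases j <;> simp [Matrix.mul_apply])

/-- The functional dual to `x`. -/
def coeffX (hm : 2 ≤ m) : TaftAlgebra m q →ₗ[K] K :=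
  Matrix.entryLinearMap K K 0 1 ∘ₗ (matrixRep m q hm).toLinearMap

variable (hm : 2 ≤ m)

lemma coeffX_apply (a : TaftAlgebra m q) : coeffX m q hm a = matrixRep m q hm a 0 1 := rfl

lemma coeffX_one : coeffX m q hm 1 = 0 := by simp [coeffX_apply]

lemma coeffX_h : coeffX m q hm (h m q) = 0 := by simp [coeffX_apply, matrixRep]

lemma coeffX_x : coeffX m q hm (x m q) = 1 := by simp [coeffX_apply, matrixRep]

lemma x_ne_zero (hm : 2 ≤ m) : x m q ≠ 0 := fun h0 => by
  have := coeffX_x m q hm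
  rw [h0, map_zero] at this
  exact zero_ne_one this

variable [NeZero m]

/-- The character `h ↦ q`, `x ↦ 0`. -/
def character : TaftAlgebra m q →ₐ[K] K :=
  lift q 0 hq.out.pow_eq_one (zero_pow (NeZero.ne m)) (by simp)

/-- The representation is upper triangular with diagonal characters the counit and `character`. Its
corner entry is therefore a skew derivation with respect to these two. -/
lemma matrixRep_entries (a : TaftAlgebra m q) :
    matrixRep m q hm a 1 0 = 0 ∧ matrixRep m q hm a 0 0 = counit (R := K) a ∧
      matrixRep m q hm a 1 1 = character m q a := by
  have ha : a ∈ Algebra.adjoin K {h m q, x m q} := adjoin_eq_top m q ▸ Algebra.mem_top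
  induction ha using Algebra.adjoin_induction with
  | mem a ha => obtain rfl | rfl := ha <;> simp [matrixRep, character]
  | algebraMap r => simp [Matrix.algebraMap_matrix_apply]
  | add a b _ _ iha ihb => simp [iha, ihb]
  | mul a b _ _ iha ihb => simp [Matrix.mul_apply, iha, ihb]

lemma coeffX_mul (a b : TaftAlgebra m q) : coeffX m q hm (a * b) =
    counit (R := K) a * coeffX m q hm b + coeffX m q hm a * character m q b := by
  simp [coeffX_apply, Matrix.mul_apply, matrixRep_entries]

lemma coeffX_h_pow (k : ℕ) : coeffX m q hm (h m q ^ k) = 0 := by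
  induction k with
  | zero => simp [coeffX_one]
  | succ k ih => simp [pow_succ, coeffX_mul, ih, coeffX_h]

lemma comul_h_pow (k : ℕ) :
    comul (R := K) (h m q ^ k) = (h m q ^ k) ⊗ₜ[K] (h m q ^ k) := by
  simp [Bialgebra.comul_pow, Algebra.TensorProduct.tmul_pow]

lemma sliceLeft_coeffX_aeval_h (p : K[X]) :
    sliceLeft (coeffX m q hm) (aeval (h m q) p) = 0 := by
  induction p using Polynomial.induction_on' with
  | add p r hp hr => simp only [map_add, hp, hr, add_zero]
  | monomial k a =>
    rw [aeval_monomial, ← Algebra.smul_def, map_smul,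
      sliceLeft_of_comul_eq_tmul_self _ (comul_h_pow m q k), coeffX_h_pow, zero_smul, smul_zero]

lemma sliceRight_coeffX_aeval_h (p : K[X]) :
    sliceRight (coeffX m q hm) (aeval (h m q) p) = 0 := by
  induction p using Polynomial.induction_on' with
  | add p r hp hr => simp only [map_add, hp, hr, add_zero]
  | monomial k a =>
    rw [aeval_monomial, ← Algebra.smul_def, map_smul,
      sliceRight_of_comul_eq_tmul_self _ (comul_h_pow m q k), coeffX_h_pow, zero_smul,
      smul_zero]

/-- The automorphism `h ↦ q h`, `x ↦ q x`. -/
def scaling : TaftAlgebra m q →ₐ[K] TaftAlgebra m q :=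
  (Algebra.TensorProduct.rid K K (TaftAlgebra m q)).toAlgHom.comp
    ((Algebra.TensorProduct.map (AlgHom.id K _) (character m q)).comp
      (Bialgebra.comulAlgHom K (TaftAlgebra m q)))

lemma scaling_x : scaling m q (x m q) = q • x m q := by
  simp [scaling, character]

/-- This is the Leibniz rule `coeffX_mul` applied to the second tensor leg: the counit there
restores `a`, and the character there turns `b` into `scaling b`. -/
lemma sliceRight_coeffX_mul (a b : TaftAlgebra m q) :
    sliceRight (coeffX m q hm) (a * b) =
      a * sliceRight (coeffX m q hm) b + sliceRight (coeffX m q hm) a * scaling m q b := by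
  -- Stated for arbitrary tensors instead of comultiplications, so that induction on pure tensors
  -- applies.
  have key : ∀ u v : TaftAlgebra m q ⊗[K] TaftAlgebra m q,
      _root_.TensorProduct.rid K _ ((coeffX m q hm).lTensor _ (u * v)) =
        _root_.TensorProduct.rid K _ ((counit (R := K)).lTensor _ u) *
          _root_.TensorProduct.rid K _ ((coeffX m q hm).lTensor _ v) +
        _root_.TensorProduct.rid K _ ((coeffX m q hm).lTensor _ u) *
          Algebra.TensorProduct.rid K K _
            (Algebra.TensorProduct.map (AlgHom.id K _) (character m q) v) := by
    intro u v
    induction u using TensorProduct.induction_on with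
    | zero => simp
    | add u u' hu hu' => simp only [add_mul, map_add, hu, hu']; abel
    | tmul a a' =>
      induction v using TensorProduct.induction_on with
      | zero => simp
      | add v v' hv hv' => simp only [mul_add, map_add, hv, hv']; abel
      | tmul b b' =>
        simp [coeffX_mul, add_smul, smul_smul, mul_comm]
  have := key (comul a) (comul b)
  rw [Coalgebra.lTensor_counit_comul, TensorProduct.rid_tmul, one_smul] at this
  rw [sliceRight_apply, Bialgebra.comul_mul, this]
  rfl

lemma sliceRight_coeffX_x : sliceRight (coeffX m q hm) (x m q) = 1 := by
  rw [sliceRight_of_skewPrimitive _ (comul_x m q), coeffX_h, coeffX_x]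
  simp

/-- A `q`-derivative: the Leibniz rule with `x ↦ 1` and the twist `x ↦ q x` produces the `q`-integer
of `b + 1`. -/
lemma sliceRight_coeffX_x_pow (b : ℕ) : sliceRight (coeffX m q hm) (x m q ^ (b + 1)) =
    (∑ i ∈ Finset.range (b + 1), q ^ i) • x m q ^ b := by
  induction b with
  | zero => simp [sliceRight_coeffX_x]
  | succ b ih =>
    rw [pow_succ' _ (b + 1), sliceRight_coeffX_mul, ih, sliceRight_coeffX_x, map_pow,
      scaling_x, _root_.smul_pow, one_mul, mul_smul_comm, ← pow_succ', ← add_smul,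
      ← Finset.sum_range_succ]

/-- Since the derivation kills `K[h]`, it is left `K[h]`-linear, and only its values on powers of
`x` matter. -/
lemma sliceRight_coeffX_aeval_mul (p : K[X]) (y : TaftAlgebra m q) :
    sliceRight (coeffX m q hm) (aeval (h m q) p * y) =
      aeval (h m q) p * sliceRight (coeffX m q hm) y := by
  rw [sliceRight_coeffX_mul, sliceRight_coeffX_aeval_h, zero_mul, add_zero]

lemma sliceRight_coeffX_pow_eq_zero {b k : ℕ} (hb : b < k) (p : K[X]) :
    (sliceRight (coeffX m q hm) ^ k) (aeval (h m q) p * x m q ^ b) = 0 := by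
  induction k generalizing b with
  | zero => omega
  | succ k ih =>
    rw [pow_succ, Module.End.mul_apply, sliceRight_coeffX_aeval_mul]
    cases b with
    | zero =>
      have := sliceRight_coeffX_aeval_h m q hm 1
      rw [map_one] at this
      rw [pow_zero, this, mul_zero, map_zero]
    | succ b =>
      rw [sliceRight_coeffX_x_pow, mul_smul_comm, map_smul, ih (by omega), smul_zero]

lemma sliceRight_coeffX_pow_apply (k : ℕ) (p : K[X]) :
    (sliceRight (coeffX m q hm) ^ k) (aeval (h m q) p * x m q ^ k) =
      (∏ b ∈ Finset.range k, ∑ i ∈ Finset.range (b + 1), q ^ i) • aeval (h m q) p := by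
  induction k with
  | zero => simp
  | succ k ih =>
    rw [pow_succ, Module.End.mul_apply, sliceRight_coeffX_aeval_mul,
      sliceRight_coeffX_x_pow, mul_smul_comm, map_smul, ih, smul_smul, mul_comm,
      Finset.prod_range_succ]

lemma sliceRight_coeffX_pow_eq_zero_of_mem {k : ℕ} {t : TaftAlgebra m q}
    (ht : t ∈ filtration m q k) : (sliceRight (coeffX m q hm) ^ k) t = 0 := by
  obtain ⟨p, rfl⟩ := (mem_filtration m q).1 ht
  rw [map_sum]
  exact Finset.sum_eq_zero fun b _ => sliceRight_coeffX_pow_eq_zero m q hm b.2 _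

/-- Every element has `x`-degree below `m`, and each application lowers the degree. This nilpotency
later forces group-likes, which are eigenvectors, into the kernel. -/
lemma sliceRight_coeffX_pow_m (t : TaftAlgebra m q) :
    (sliceRight (coeffX m q hm) ^ m) t = 0 :=
  sliceRight_coeffX_pow_eq_zero_of_mem m q hm
    (filtration_eq_top m q ▸ Submodule.mem_top)

/-- Descent on the degree in `x`: iterating the derivation as often as the top exponent isolates the
top coefficient times a `q`-factorial. That factorial is nonzero below `m`, so the top term
vanishes. -/
lemma mem_filtration_one_of_sliceRight_eq_zero {k : ℕ} (hk : k + 1 ≤ m) {t : TaftAlgebra m q}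
    (ht : t ∈ filtration m q (k + 1)) (h0 : sliceRight (coeffX m q hm) t = 0) :
    t ∈ filtration m q 1 := by
  induction k with
  | zero => exact ht
  | succ k ih =>
    refine ih (by omega) ?_
    obtain ⟨p, rfl⟩ := (mem_filtration m q).1 ht
    rw [Fin.sum_univ_castSucc] at h0 ⊢
    set r := ∑ b : Fin (k + 1), aeval (h m q) (p b.castSucc) * x m q ^ (b.castSucc : ℕ) with hr
    have hmem : r ∈ filtration m q (k + 1) :=
      (mem_filtration m q).2 ⟨fun b => p b.castSucc, rfl⟩
    have h1 : (sliceRight (coeffX m q hm) ^ (k + 1))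
        (r + aeval (h m q) (p (Fin.last _)) * x m q ^ (k + 1)) = 0 := by
      rw [pow_succ, Module.End.mul_apply]
      exact (congrArg _ h0).trans (map_zero _)
    rw [map_add, sliceRight_coeffX_pow_eq_zero_of_mem m q hm hmem, zero_add,
      sliceRight_coeffX_pow_apply, smul_eq_zero] at h1
    -- Primitivity of `q` makes every factor of the `q`-factorial nonzero, since the exponents stay
    -- below `m`.
    have h2 := h1.resolve_left (Finset.prod_ne_zero_iff.2 fun b hb =>
      geom_sum_ne_zero m q (by have := Finset.mem_range.1 hb; omega))
    rw [h2, zero_mul, add_zero]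
    exact hmem

/-- The kernel of the skew derivation dual to `x` is the subalgebra generated by `h`. -/
lemma exists_aeval_h_of_sliceRight_eq_zero {t : TaftAlgebra m q}
    (h0 : sliceRight (coeffX m q hm) t = 0) : ∃ p : K[X], aeval (h m q) p = t := by
  have ht : t ∈ filtration m q (m - 1 + 1) := by
    rw [Nat.sub_add_cancel (NeZero.pos m), filtration_eq_top]
    exact Submodule.mem_top
  obtain ⟨p, hp⟩ := (mem_filtration m q).1
    (mem_filtration_one_of_sliceRight_eq_zero m q hm (by omega) ht h0)
  exact ⟨p 0, by simpa using hp⟩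

/-! ### Group-like and skew-primitive elements of the Taft algebra. -/

instance : Nontrivial (TaftAlgebra m q) := (counitHom m q).toRingHom.domain_nontrivial

/-- If `t` is group-like, `s` is a `(t, 1)`-skew primitive element, and `s t = q t s`, then either
`s = 0` or `t = h` and `s` is a multiple of `x`. -/
lemma eq_h_and_eq_smul_x (hm : 2 ≤ m) {s t : TaftAlgebra m q} (ht : IsGroupLikeElem K t)
    (hs : comul (R := K) s = s ⊗ₜ t + 1 ⊗ₜ s) (hst : s * t = q • (t * s)) (hs0 : s ≠ 0) :
    t = h m q ∧ ∃ ω : K, s = ω • x m q := by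
  have hq1 : q ≠ 1 := fun h1 => by
    have := hq.out.pow_ne_one_of_pos_of_lt (l := 1) (by omega) (by omega)
    simp [h1] at this
  have hDt := sliceRight_of_comul_eq_tmul_self (coeffX m q hm) ht.comul_eq_tmul_self
  -- A group-like `t` is an eigenvector of the nilpotent derivation with eigenvalue `coeffX t`.
  have ht0 : coeffX m q hm t = 0 := by
    have hpow : ∀ k : ℕ, (sliceRight (coeffX m q hm) ^ k) t = coeffX m q hm t ^ k • t := by
      intro k
      induction k with
      | zero => simp
      | succ k ih =>
        rw [pow_succ, Module.End.mul_apply, hDt, map_smul, ih, smul_smul, ← pow_succ']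
    have := hpow m
    rw [sliceRight_coeffX_pow_m] at this
    exact eq_zero_of_pow_eq_zero ((smul_eq_zero.1 this.symm).resolve_right ht.ne_zero)
  rw [ht0, zero_smul] at hDt
  obtain ⟨p, hp⟩ := exists_aeval_h_of_sliceRight_eq_zero m q hm hDt
  have hDs := sliceRight_of_skewPrimitive (coeffX m q hm) hs
  rw [ht0, zero_smul, zero_add] at hDs
  -- The derivation sends `s` to the scalar `coeffX s` and `x` to `1`, so `s` agrees with a multiple
  -- of `x` modulo `K[h]`.
  have hDr : sliceRight (coeffX m q hm) (s - coeffX m q hm s • x m q) = 0 := by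
    rw [map_sub, map_smul, hDs, sliceRight_coeffX_x, sub_self]
  obtain ⟨r, hr⟩ := exists_aeval_h_of_sliceRight_eq_zero m q hm hDr
  -- An element that both commutes and `q`-commutes with a unit vanishes, because `q ≠ 1`.
  have hcancel : ∀ u v : TaftAlgebra m q, IsUnit v → u * v = v * u → u * v = q • (v * u) →
      u = 0 := by
    intro u v hv h1 h2
    rw [← h1, ← sub_eq_zero, ← one_smul K (u * v), smul_smul, mul_one, ← sub_smul,
      smul_eq_zero] at h2
    exact hv.mul_left_eq_zero.1 (h2.resolve_left (sub_ne_zero.2 hq1.symm))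
  have hcomm : ∀ u v : K[X], aeval (h m q) u * aeval (h m q) v =
      aeval (h m q) v * aeval (h m q) u := fun u v => by rw [← map_mul, mul_comm, map_mul]
  by_cases hω : coeffX m q hm s = 0
  · rw [hω, zero_smul, sub_zero] at hr
    exact absurd (hcancel s t ht.isUnit (by rw [← hr, ← hp, hcomm]) hst) hs0
  -- Slicing the left leg instead kills `K[h]` while it sends `s` to `coeffX s • t` and `x` to `h`;
  -- comparing the two gives `t = h`.
  have hth : t = h m q := by
    have h1 := sliceLeft_of_skewPrimitive (coeffX m q hm) hs
    have h2 := sliceLeft_of_skewPrimitive (coeffX m q hm) (comul_x m q)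
    have h3 := sliceLeft_coeffX_aeval_h m q hm r
    rw [hr, map_sub, map_smul, h1, h2, coeffX_one, coeffX_x, zero_smul, zero_smul, add_zero,
      add_zero, one_smul, ← smul_sub, smul_eq_zero] at h3
    exact sub_eq_zero.1 (h3.resolve_left hω)
  refine ⟨hth, coeffX m q hm s, ?_⟩
  rw [← sub_eq_zero]
  have hhu : IsUnit (h m q) := hth ▸ ht.isUnit
  -- The remainder `s - coeffX s • x` commutes with `h` as a polynomial in `h`, and it `q`-commutes
  -- with `h` because `s` and `x` both do.
  refine hcancel _ _ hhu ?_ ?_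
  · have := hcomm r X
    rwa [hr, aeval_X] at this
  · rw [sub_mul, mul_sub, smul_sub, ← hth, hst, hth, smul_mul_assoc, x_mul_h, mul_smul_comm,
      smul_comm]

end TaftAlgebra

/-! ### The group algebra of a cyclic group -/

section CyclicGroup

variable (K : Type*) [Field K] (n : ℕ)

/-- The generator of the cyclic group of order `n`, as an element of the group algebra. -/
def cyclicGen : MonoidAlgebra K (Multiplicative (ZMod n)) :=
  MonoidAlgebra.single (Multiplicative.ofAdd 1) 1

lemma cyclicGen_pow (k : ℕ) :
    cyclicGen K n ^ k = MonoidAlgebra.single (Multiplicative.ofAdd (k : ZMod n)) 1 := by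
  rw [cyclicGen, MonoidAlgebra.single_pow, one_pow, ← ofAdd_nsmul, nsmul_one]

lemma cyclicGen_pow_self : cyclicGen K n ^ n = 1 := by
  rw [cyclicGen_pow, ZMod.natCast_self, ofAdd_zero, MonoidAlgebra.one_def]

lemma comul_cyclicGen :
    Coalgebra.comul (R := K) (cyclicGen K n) = cyclicGen K n ⊗ₜ cyclicGen K n := by
  simp [cyclicGen]

lemma counit_cyclicGen : Coalgebra.counit (R := K) (cyclicGen K n) = 1 := by
  simp [cyclicGen]

variable [NeZero n]

lemma single_eq_cyclicGen_pow (z : Multiplicative (ZMod n)) :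
    MonoidAlgebra.single z (1 : K) = cyclicGen K n ^ z.toAdd.val := by
  rw [cyclicGen_pow, ZMod.natCast_zmod_val, ofAdd_toAdd]

variable {K n} {B : Type*} [Ring B] [Algebra K B]

lemma cyclic_linearMap_ext {M : Type*} [AddCommGroup M] [Module K M]
    {f f' : MonoidAlgebra K (Multiplicative (ZMod n)) →ₗ[K] M}
    (hf : ∀ k : ℕ, f (cyclicGen K n ^ k) = f' (cyclicGen K n ^ k)) : f = f' := by
  refine MonoidAlgebra.lhom_ext' fun z => LinearMap.ext_ring ?_
  simpa [single_eq_cyclicGen_pow] using hf z.toAdd.val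

lemma cyclic_algHom_ext {f f' : MonoidAlgebra K (Multiplicative (ZMod n)) →ₐ[K] B}
    (hf : f (cyclicGen K n) = f' (cyclicGen K n)) : f = f' :=
  AlgHom.toLinearMap_injective (cyclic_linearMap_ext fun k => by simp [hf])

/-- The universal property of the group algebra of a cyclic group. -/
def cyclicLift (c : B) (hc : c ^ n = 1) :
    MonoidAlgebra K (Multiplicative (ZMod n)) →ₐ[K] B :=
  MonoidAlgebra.lift K B (Multiplicative (ZMod n))
    { toFun := fun z => c ^ z.toAdd.val
      map_one' := by simp
      map_mul' := fun z w => by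
        rw [toAdd_mul, ZMod.val_add, ← pow_add, ← pow_eq_pow_mod _ hc] }

lemma cyclicLift_gen (c : B) (hc : c ^ n = 1) : cyclicLift c hc (cyclicGen K n) = c := by
  -- When `n = 1` this exponent is `0`, not `1`, hence the comparison modulo `n`.
  have h1 : cyclicLift c hc (cyclicGen K n) = c ^ (1 : ZMod n).val := by
    simp [cyclicLift, cyclicGen]
  rw [h1, ZMod.val_one_eq_one_mod, ← pow_eq_pow_mod _ hc, pow_one]

end CyclicGroup

/-! ### Factorizations -/

section Factorization

variable {K E A H : Type*} [Field K] [Ring E] [Ring A] [Ring H]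
  [HopfAlgebra K E] [HopfAlgebra K A] [HopfAlgebra K H]

/-- The linear map `A ⊗ H → E`, `a ⊗ y ↦ i a * j y`. -/
def factorMap (i : A →ₐc[K] E) (j : H →ₐc[K] E) : A ⊗[K] H →ₗ[K] E :=
  LinearMap.mul' K E ∘ₗ
    TensorProduct.map (i : A →ₐ[K] E).toLinearMap (j : H →ₐ[K] E).toLinearMap

@[simp]
lemma factorMap_tmul (i : A →ₐc[K] E) (j : H →ₐc[K] E) (a : A) (y : H) :
    factorMap i j (a ⊗ₜ y) = i a * j y := rfl

/-- Injectivity of the two maps is automatic: restrict the bijection to `a ⊗ 1` or `1 ⊗ y`, then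
recover `a` or `y` with the counit on the other leg. -/
lemma factorizesThrough_of_bijective (i : A →ₐc[K] E) (j : H →ₐc[K] E)
    (hij : Function.Bijective (factorMap i j)) : FactorizesThrough K E A H := by
  refine ⟨i, j, fun a a' haa => ?_, fun y y' hyy => ?_, hij⟩
  · have h1 : a ⊗ₜ[K] (1 : H) = a' ⊗ₜ 1 := hij.1 (by simp [haa])
    simpa using congrArg
      (TensorProduct.rid K A ∘ (Coalgebra.counit (R := K) (A := H)).lTensor A) h1
  · have h1 : (1 : A) ⊗ₜ[K] y = 1 ⊗ₜ y' := hij.1 (by simp [hyy])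
    simpa using congrArg
      (TensorProduct.lid K H ∘ (Coalgebra.counit (R := K) (A := A)).rTensor H) h1

end Factorization

/-! ### The cyclic group action on the Taft algebra. -/

namespace TaftAlgebra

variable {K : Type*} [Field K] (m : ℕ) (q ω : K)

/-- The endomorphism `h ↦ h`, `x ↦ ω x` of the Taft algebra. -/
def twist : TaftAlgebra m q →ₐ[K] TaftAlgebra m q :=
  lift (h m q) (ω • x m q) (h_pow m q) (by rw [smul_pow, x_pow, smul_zero])
    (by rw [smul_mul_assoc, x_mul_h, mul_smul_comm, smul_comm])

@[simp]
lemma twist_h : twist m q ω (h m q) = h m q := lift_h _ _ _ _ _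

@[simp]
lemma twist_x : twist m q ω (x m q) = ω • x m q := lift_x _ _ _ _ _

/-- This is where `ω ^ n = 1` enters the converse direction: it lets `g` act on the tensor product
with `g ^ n = 1`. -/
lemma twist_pow_of_pow_eq_one {n : ℕ} (hω : ω ^ n = 1) :
    (twist m q ω).toLinearMap ^ n = 1 := by
  have hx : ∀ k : ℕ, (twist m q ω ^ k) (x m q) = ω ^ k • x m q := by
    intro k
    induction k with
    | zero => simp
    | succ k ih => rw [pow_succ, AlgHom.mul_apply, twist_x, map_smul, ih, smul_smul, pow_succ']
  have hh : ∀ k : ℕ, (twist m q ω ^ k) (h m q) = h m q := by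
    intro k
    induction k with
    | zero => simp
    | succ k ih => rw [pow_succ, AlgHom.mul_apply, twist_h, ih]
  have h1 : twist m q ω ^ n = 1 := algHom_ext (by simp [hh]) (by simp [hx, hω])
  ext a
  rw [Module.End.pow_apply]
  have := DFunLike.congr_fun h1 a
  rwa [AlgHom.coe_pow] at this

end TaftAlgebra

/-! ### The factorization of `T^ω_{nm²}(q)`. -/

namespace ExtTaftAlgebra

variable {K : Type*} [Field K] (n m : ℕ) (q ω : K) [NeZero m]
  [hq : Fact (IsPrimitiveRoot q m)]

/-- The embedding of the Taft algebra. -/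
def ofTaft : TaftAlgebra m q →ₐc[K] ExtTaftAlgebra n m q ω :=
  .ofAlgHom (TaftAlgebra.lift (h n m q ω) (x n m q ω) (h_pow n m q ω) (x_pow n m q ω)
      (x_mul_h n m q ω))
    (by apply TaftAlgebra.algHom_ext <;> simp)
    (by apply TaftAlgebra.algHom_ext <;> simp)

@[simp]
lemma ofTaft_h : ofTaft n m q ω (TaftAlgebra.h m q) = h n m q ω := TaftAlgebra.lift_h _ _ _ _ _

@[simp]
lemma ofTaft_x : ofTaft n m q ω (TaftAlgebra.x m q) = x n m q ω := TaftAlgebra.lift_x _ _ _ _ _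

/-- Conjugation by `g` on the Taft part is the twist; the defining relations say so on generators,
and both sides are multiplicative in `a`. -/
lemma g_mul_ofTaft (a : TaftAlgebra m q) :
    g n m q ω * ofTaft n m q ω a = ofTaft n m q ω (TaftAlgebra.twist m q ω a) * g n m q ω := by
  have ha : a ∈ Algebra.adjoin K {TaftAlgebra.h m q, TaftAlgebra.x m q} :=
    TaftAlgebra.adjoin_eq_top m q ▸ Algebra.mem_top
  induction ha using Algebra.adjoin_induction with
  | mem a ha => obtain rfl | rfl := ha <;> simp [h_mul_g, g_mul_x]
  | algebraMap r =>
    simp only [AlgHom.commutes, ← BialgHom.coe_toAlgHom]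
    exact (Algebra.commutes _ _).symm
  | add a b _ _ iha ihb => simp only [map_add, mul_add, add_mul, iha, ihb]
  | mul a b _ _ iha ihb =>
    rw [map_mul, map_mul, map_mul, ← mul_assoc, iha, mul_assoc, ihb, mul_assoc]

/-- The representation of `T^ω_{nm²}(q)` on the tensor product of the Taft algebra and the group
algebra. -/
def tensorRep (hω : ω ^ n = 1) : ExtTaftAlgebra n m q ω →ₐ[K]
    Module.End K (TaftAlgebra m q ⊗[K] MonoidAlgebra K (Multiplicative (ZMod n))) :=
  lift
    (TensorProduct.map (TaftAlgebra.twist m q ω).toLinearMap (Algebra.lmul K _ (cyclicGen K n)))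
    (TensorProduct.map (Algebra.lmul K _ (TaftAlgebra.h m q)) 1)
    (TensorProduct.map (Algebra.lmul K _ (TaftAlgebra.x m q)) 1)
    (by rw [TensorProduct.map_pow, ← map_pow, cyclicGen_pow_self,
      TaftAlgebra.twist_pow_of_pow_eq_one m q ω hω, map_one, TensorProduct.map_one])
    (by rw [TensorProduct.map_pow, ← map_pow, TaftAlgebra.h_pow, map_one, one_pow,
      TensorProduct.map_one])
    (by rw [TensorProduct.map_pow, ← map_pow, TaftAlgebra.x_pow, map_zero,
      TensorProduct.map_zero_left])
    (by rw [← TensorProduct.map_mul, ← TensorProduct.map_mul, ← map_mul, ← map_mul,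
      TaftAlgebra.x_mul_h, map_smul, TensorProduct.map_smul_left])
    (by ext; simp [Module.End.mul_apply])
    (by ext; simp [Module.End.mul_apply, TensorProduct.smul_tmul'])

lemma tensorRep_ofTaft (hω : ω ^ n = 1) (a : TaftAlgebra m q) :
    tensorRep n m q ω hω (ofTaft n m q ω a) = TensorProduct.map (Algebra.lmul K _ a) 1 := by
  have h1 : (tensorRep n m q ω hω).comp (ofTaft n m q ω : _ →ₐ[K] _) =
      (Module.End.rTensorAlgHom K (TaftAlgebra m q)
        (MonoidAlgebra K (Multiplicative (ZMod n)))).comp (Algebra.lmul K (TaftAlgebra m q)) := by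
    apply TaftAlgebra.algHom_ext
    · simp [tensorRep]; rfl
    · simp [tensorRep]; rfl
  exact DFunLike.congr_fun h1 a

variable [NeZero n]

/-- The embedding of the group algebra. -/
def ofCyclic : MonoidAlgebra K (Multiplicative (ZMod n)) →ₐc[K] ExtTaftAlgebra n m q ω :=
  .ofAlgHom (cyclicLift (g n m q ω) (g_pow n m q ω))
    (cyclic_algHom_ext (by simp [cyclicLift_gen, counit_cyclicGen]))
    (cyclic_algHom_ext (by simp [cyclicLift_gen, comul_cyclicGen]))

@[simp]
lemma ofCyclic_gen : ofCyclic n m q ω (cyclicGen K n) = g n m q ω :=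
  cyclicLift_gen (g n m q ω) (g_pow n m q ω)

/-- The range contains `1` and is stable under left multiplication by the generators; for `g` this
uses the twist to move it past the Taft factor. -/
lemma factorMap_surjective :
    Function.Surjective (factorMap (ofTaft n m q ω) (ofCyclic n m q ω)) := by
  rw [← LinearMap.range_eq_top]
  refine Submodule.eq_top_of_adjoin_eq_top (adjoin_eq_top n m q ω) _ ⟨1 ⊗ₜ 1, by simp⟩ ?_
  rintro a ha _ ⟨w, rfl⟩
  induction w using TensorProduct.induction_on with
  | zero => simp
  | add u v hu hv => rw [map_add, mul_add]; exact Submodule.add_mem _ hu hv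
  | tmul t y =>
    rw [factorMap_tmul, ← mul_assoc]
    obtain rfl | rfl | rfl := ha
    · refine ⟨TaftAlgebra.twist m q ω t ⊗ₜ (cyclicGen K n * y), ?_⟩
      rw [g_mul_ofTaft, factorMap_tmul, map_mul, ofCyclic_gen, mul_assoc]
    · exact ⟨(TaftAlgebra.h m q * t) ⊗ₜ y, by simp⟩
    · exact ⟨(TaftAlgebra.x m q * t) ⊗ₜ y, by simp⟩

/-- The twist fixes `1`, so powers of `g` act on `1 ⊗ 1` only through the second factor. -/
lemma tensorRep_ofCyclic (hω : ω ^ n = 1) (y : MonoidAlgebra K (Multiplicative (ZMod n))) :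
    tensorRep n m q ω hω (ofCyclic n m q ω y) (1 ⊗ₜ 1) = 1 ⊗ₜ y := by
  have h1 : (LinearMap.applyₗ (1 ⊗ₜ 1)) ∘ₗ (tensorRep n m q ω hω).toLinearMap ∘ₗ
      (ofCyclic n m q ω : _ →ₐ[K] _).toLinearMap =
      TensorProduct.mk K (TaftAlgebra m q) (MonoidAlgebra K (Multiplicative (ZMod n))) 1 := by
    refine cyclic_linearMap_ext fun k => ?_
    induction k with
    | zero => simp
    | succ k ih =>
      simp only [LinearMap.comp_apply, AlgHom.toLinearMap_apply, map_pow,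
        LinearMap.applyₗ_apply_apply, TensorProduct.mk_apply, BialgHom.coe_toAlgHom,
        ofCyclic_gen] at ih ⊢
      rw [pow_succ', Module.End.mul_apply, ih, pow_succ']
      simp [tensorRep]
  exact DFunLike.congr_fun h1 y

lemma factorMap_bijective (hω : ω ^ n = 1) :
    Function.Bijective (factorMap (ofTaft n m q ω) (ofCyclic n m q ω)) := by
  refine ⟨?_, factorMap_surjective n m q ω⟩
  -- Acting on the vector `1 ⊗ 1` is a left inverse of the product map.
  refine Function.LeftInverse.injective
    (g := fun e => tensorRep n m q ω hω e (1 ⊗ₜ 1)) fun w => ?_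
  induction w using TensorProduct.induction_on with
  | zero => simp
  | add u v hu hv => simp only [map_add, LinearMap.add_apply] at hu hv ⊢; rw [hu, hv]
  | tmul t y =>
    simp [tensorRep_ofTaft, tensorRep_ofCyclic]

end ExtTaftAlgebra

/-! ### The coefficient functional on the cyclic group algebra. -/

section CyclicCoeff

variable (K : Type*) [Field K] (n : ℕ)

/-- The coefficient of the generator in the group algebra of a cyclic group. -/
def cyclicCoeff : MonoidAlgebra K (Multiplicative (ZMod n)) →ₗ[K] K :=
  Finsupp.lapply (Multiplicative.ofAdd 1) ∘ₗ (MonoidAlgebra.coeffLinearEquiv K).toLinearMap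

lemma cyclicCoeff_gen : cyclicCoeff K n (cyclicGen K n) = 1 := by
  simp [cyclicCoeff, cyclicGen]

/-- The coefficient vanishes unless the power is the generator itself. Replacing the power by the
generator makes the right side linear in the group-algebra element. -/
lemma cyclicCoeff_smul_pow (k : ℕ) : cyclicCoeff K n (cyclicGen K n ^ k) • cyclicGen K n ^ k =
    cyclicCoeff K n (cyclicGen K n ^ k) • cyclicGen K n := by
  classical
  rw [cyclicGen_pow]
  by_cases hk : Multiplicative.ofAdd (k : ZMod n) = Multiplicative.ofAdd 1
  · rw [hk]; rfl
  · have : cyclicCoeff K n (MonoidAlgebra.single (Multiplicative.ofAdd (k : ZMod n)) 1) = 0 := by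
      simp [cyclicCoeff, hk]
    rw [this, zero_smul, zero_smul]

end CyclicCoeff

/-! ### Hopf algebras that factorize through the Taft algebra and a cyclic group algebra -/

namespace TaftFactorization

open Coalgebra

variable {K E A : Type*} [Field K] [Ring E] [HopfAlgebra K E] [Ring A] [HopfAlgebra K A]
  {n : ℕ} {i : A →ₐc[K] E}
  {j : MonoidAlgebra K (Multiplicative (ZMod n)) →ₐc[K] E}
  (hij : Function.Bijective (factorMap i j))

/-- The functional `i a * j y ↦ ε(a) δ(y)`, where `δ(y)` is the coefficient of the generator. -/
def functional : E →ₗ[K] K :=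
  (TensorProduct.lid K K).toLinearMap ∘ₗ TensorProduct.map counit (cyclicCoeff K n) ∘ₗ
    (LinearEquiv.ofBijective (factorMap i j) hij).symm.toLinearMap

lemma functional_mul (a : A) (y : MonoidAlgebra K (Multiplicative (ZMod n))) :
    functional hij (i a * j y) = counit (R := K) a * cyclicCoeff K n y := by
  have : (LinearEquiv.ofBijective (factorMap i j) hij).symm (i a * j y) = a ⊗ₜ y := by
    rw [LinearEquiv.symm_apply_eq]; rfl
  simp [functional, this]

lemma functional_gen : functional hij (j (cyclicGen K n)) = 1 := by
  simpa [cyclicCoeff_gen] using functional_mul hij 1 (cyclicGen K n)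

lemma comul_mul_pow (a : A) (k : ℕ) : comul (R := K) (i a * j (cyclicGen K n ^ k)) =
    TensorProduct.map (i : A →ₐ[K] E).toLinearMap (i : A →ₐ[K] E).toLinearMap (comul a) *
      (j (cyclicGen K n ^ k) ⊗ₜ j (cyclicGen K n ^ k)) := by
  have h1 : comul (R := K) (i a) = TensorProduct.map (i : A →ₐ[K] E).toLinearMap
      (i : A →ₐ[K] E).toLinearMap (comul a) := (CoalgHomClass.map_comp_comul_apply i a).symm
  have h2 : IsGroupLikeElem K (cyclicGen K n) := ⟨counit_cyclicGen K n, comul_cyclicGen K n⟩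
  rw [Bialgebra.comul_mul, h1, ((h2.pow (n := k)).map j).comul_eq_tmul_self]

variable [NeZero n]

/-- The slice is the projection of `E` onto `i(A) g`. It suffices to take `y` a power of `g`: such a
`y` is group-like, and the counit absorbs the second leg of `a`. -/
lemma sliceRight_functional_mul (a : A) (y : MonoidAlgebra K (Multiplicative (ZMod n))) :
    sliceRight (functional hij) (i a * j y) =
      cyclicCoeff K n y • (i a * j (cyclicGen K n)) := by
  have key : ∀ (k : ℕ) (w : A ⊗[K] A), TensorProduct.rid K E ((functional hij).lTensor E
      (TensorProduct.map (i : A →ₐ[K] E).toLinearMap (i : A →ₐ[K] E).toLinearMap w *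
        (j (cyclicGen K n ^ k) ⊗ₜ j (cyclicGen K n ^ k)))) =
      i (TensorProduct.rid K A ((counit (R := K)).lTensor A w)) *
        j (cyclicCoeff K n (cyclicGen K n ^ k) • cyclicGen K n ^ k) := by
    intro k w
    induction w using TensorProduct.induction_on with
    | zero => simp
    | add u v hu hv => simp only [map_add, add_mul, hu, hv]
    | tmul b b' =>
      simp only [TensorProduct.map_tmul, Algebra.TensorProduct.tmul_mul_tmul,
        AlgHom.toLinearMap_apply, BialgHom.coe_toAlgHom, LinearMap.lTensor_tmul, functional_mul,
        TensorProduct.rid_tmul, map_smul, smul_mul_assoc, mul_smul_comm, smul_smul, mul_comm]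
  have h1 : sliceRight (functional hij) ∘ₗ LinearMap.mulLeft K (i a) ∘ₗ
      (j : _ →ₐ[K] E).toLinearMap =
      (cyclicCoeff K n).smulRight (i a * j (cyclicGen K n)) := by
    refine cyclic_linearMap_ext fun k => ?_
    have := key k (comul a)
    rw [← comul_mul_pow, Coalgebra.lTensor_counit_comul, TensorProduct.rid_tmul, one_smul,
      cyclicCoeff_smul_pow, map_smul, mul_smul_comm] at this
    exact this
  exact DFunLike.congr_fun h1 y

lemma sliceLeft_functional_mul (a : A) (y : MonoidAlgebra K (Multiplicative (ZMod n))) :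
    sliceLeft (functional hij) (i a * j y) =
      cyclicCoeff K n y • (i a * j (cyclicGen K n)) := by
  have key : ∀ (k : ℕ) (w : A ⊗[K] A), TensorProduct.lid K E ((functional hij).rTensor E
      (TensorProduct.map (i : A →ₐ[K] E).toLinearMap (i : A →ₐ[K] E).toLinearMap w *
        (j (cyclicGen K n ^ k) ⊗ₜ j (cyclicGen K n ^ k)))) =
      i (TensorProduct.lid K A ((counit (R := K)).rTensor A w)) *
        j (cyclicCoeff K n (cyclicGen K n ^ k) • cyclicGen K n ^ k) := by
    intro k w
    induction w using TensorProduct.induction_on with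
    | zero => simp
    | add u v hu hv => simp only [map_add, add_mul, hu, hv]
    | tmul b b' =>
      simp only [TensorProduct.map_tmul, Algebra.TensorProduct.tmul_mul_tmul,
        AlgHom.toLinearMap_apply, BialgHom.coe_toAlgHom, LinearMap.rTensor_tmul, functional_mul,
        TensorProduct.lid_tmul, map_smul, smul_mul_assoc, mul_smul_comm, smul_smul, mul_comm]
  have h1 : sliceLeft (functional hij) ∘ₗ LinearMap.mulLeft K (i a) ∘ₗ
      (j : _ →ₐ[K] E).toLinearMap =
      (cyclicCoeff K n).smulRight (i a * j (cyclicGen K n)) := by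
    refine cyclic_linearMap_ext fun k => ?_
    have := key k (comul a)
    rw [← comul_mul_pow, Coalgebra.rTensor_counit_comul, TensorProduct.lid_tmul, one_smul,
      cyclicCoeff_smul_pow, map_smul, mul_smul_comm] at this
    exact this
  exact DFunLike.congr_fun h1 y

/-- Both slices are the same projection. This symmetry lets the two expansions of a skew-primitive
element be equated. -/
lemma sliceLeft_eq_sliceRight : sliceLeft (functional hij) = sliceRight (functional hij) := by
  ext e
  obtain ⟨w, rfl⟩ := hij.2 e
  induction w using TensorProduct.induction_on with
  | zero => simp
  | add u v hu hv => simp only [map_add, hu, hv]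
  | tmul a y => rw [factorMap_tmul, sliceLeft_functional_mul, sliceRight_functional_mul]

lemma exists_sliceRight_eq (e : E) :
    ∃ a : A, sliceRight (functional hij) e = i a * j (cyclicGen K n) := by
  obtain ⟨w, rfl⟩ := hij.2 e
  induction w using TensorProduct.induction_on with
  | zero => exact ⟨0, by simp⟩
  | add u v hu hv =>
    obtain ⟨a, ha⟩ := hu
    obtain ⟨b, hb⟩ := hv
    exact ⟨a + b, by rw [map_add, map_add, ha, hb, map_add, add_mul]⟩
  | tmul a y =>
    exact ⟨cyclicCoeff K n y • a, by
      rw [factorMap_tmul, sliceRight_functional_mul, map_smul, smul_mul_assoc]⟩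

/-- If `u` is group-like and `v` is `(u, g)`-skew primitive, where `g` is the image of the cyclic
generator, then either `v` is a multiple of `g - u` or both `u` and `v` lie in `i(A) g`. -/
lemma eq_smul_or_exists (hij : Function.Bijective (factorMap i j)) {u v : E} (hu : IsGroupLikeElem K u)
    (hv : comul (R := K) v = v ⊗ₜ u + j (cyclicGen K n) ⊗ₜ v) :
    (∃ c : K, v = c • (j (cyclicGen K n) - u)) ∨
      ∃ t s : A, u = i t * j (cyclicGen K n) ∧ v = i s * j (cyclicGen K n) := by
  have h1 := sliceRight_of_comul_eq_tmul_self (functional hij) hu.comul_eq_tmul_self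
  have h2 := sliceRight_of_skewPrimitive (functional hij) hv
  have h3 := sliceLeft_of_skewPrimitive (functional hij) hv
  by_cases hf : functional hij u = 0
  · left
    refine ⟨functional hij v, ?_⟩
    -- With `f` the functional, `g` the image of the generator and `f u = 0`, the two slices of `v`
    -- read `f(v) g = f(v) u + v`.
    rw [sliceLeft_eq_sliceRight, h2, hf, functional_gen, zero_smul, zero_add, one_smul] at h3
    rw [smul_sub, h3, add_sub_cancel_left]
  · right
    obtain ⟨a, ha⟩ := exists_sliceRight_eq hij u
    obtain ⟨b, hb⟩ := exists_sliceRight_eq hij v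
    -- Solve `i(a) g = f(u) u` and `i(b) g = f(u) v + f(v) g` for `u` and `v`.
    refine ⟨(functional hij u)⁻¹ • a, (functional hij u)⁻¹ • (b - functional hij v • 1), ?_, ?_⟩
    · rw [map_smul, smul_mul_assoc, ← ha, h1, smul_smul, inv_mul_cancel₀ hf, one_smul]
    · rw [map_smul, map_sub, map_smul, map_one, smul_mul_assoc, sub_mul, ← hb, h2, smul_mul_assoc,
        one_mul, add_sub_cancel_right, smul_smul, inv_mul_cancel₀ hf, one_smul]

end TaftFactorization

/-! ### The relations between the two factors and the classification. -/

/-- Over a field `i ⊗ i` is injective by flatness, so comultiplication formulas computed in `E` can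
be pulled back to `A`. -/
lemma BialgHom.comul_eq_of_injective {K A E : Type*} [Field K] [Ring A] [Ring E] [Bialgebra K A]
    [Bialgebra K E] {i : A →ₐc[K] E} (hi : Function.Injective i) {a : A} {w : A ⊗[K] A}
    (h : Coalgebra.comul (R := K) (i a) = TensorProduct.map (i : A →ₐ[K] E).toLinearMap
      (i : A →ₐ[K] E).toLinearMap w) : Coalgebra.comul (R := K) a = w := by
  have hinj : Function.Injective (TensorProduct.map (i : A →ₐ[K] E).toLinearMap
      (i : A →ₐ[K] E).toLinearMap) :=
    TensorProduct.map_injective_of_flat_flat _ _ hi hi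
  exact hinj ((CoalgHomClass.map_comp_comul_apply i a).trans h)

open Coalgebra in
/-- In a Hopf algebra that factorizes through the Taft algebra and a cyclic group algebra, the
generators of the two factors satisfy `h g = g h` and `g x = ω x g` with `ω ^ n = 1`. -/
lemma TaftFactorization.exists_relations {K E : Type*} [Field K] [Ring E] [HopfAlgebra K E]
    {n m : ℕ} [NeZero n] [NeZero m] (hm : 2 ≤ m) {q : K} [Fact (IsPrimitiveRoot q m)]
    {i : TaftAlgebra m q →ₐc[K] E} {j : MonoidAlgebra K (Multiplicative (ZMod n)) →ₐc[K] E}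
    (hi : Function.Injective i) (hij : Function.Bijective (factorMap i j)) :
    ∃ ω : K, ω ^ n = 1 ∧
      i (TaftAlgebra.h m q) * j (cyclicGen K n) = j (cyclicGen K n) * i (TaftAlgebra.h m q) ∧
      j (cyclicGen K n) * i (TaftAlgebra.x m q) =
        ω • (i (TaftAlgebra.x m q) * j (cyclicGen K n)) := by
  set G := j (cyclicGen K n) with hG
  set H := i (TaftAlgebra.h m q) with hH
  set X := i (TaftAlgebra.x m q) with hX
  have hGn : G ^ n = 1 := by rw [hG, ← map_pow, cyclicGen_pow_self, map_one]
  have hG1 : G * G ^ (n - 1) = 1 := by rw [mul_pow_sub_one (NeZero.ne n), hGn]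
  have hG2 : G ^ (n - 1) * G = 1 := by rw [pow_sub_one_mul (NeZero.ne n), hGn]
  set G' := G ^ (n - 1) with hG'
  have hX0 : X ≠ 0 := fun h0 =>
    TaftAlgebra.x_ne_zero m q hm (hi (by rw [← hX, h0, map_zero]))
  have gG : IsGroupLikeElem K G :=
    IsGroupLikeElem.map j ⟨counit_cyclicGen K n, comul_cyclicGen K n⟩
  have gG' : IsGroupLikeElem K G' := gG.pow
  have gH : IsGroupLikeElem K H :=
    IsGroupLikeElem.map i ⟨TaftAlgebra.counit_h m q, TaftAlgebra.comul_h m q⟩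
  have cX : comul (R := K) X = X ⊗ₜ H + 1 ⊗ₜ X := by
    have := CoalgHomClass.map_comp_comul_apply i (TaftAlgebra.x m q)
    rw [← this]
    simp [hX, hH]
  have hXH : X * H = q • (H * X) := by
    rw [hX, hH, ← map_mul, TaftAlgebra.x_mul_h, map_smul, map_mul]
  have cv : comul (R := K) (G * X) = (G * X) ⊗ₜ (G * H) + G ⊗ₜ (G * X) := by
    rw [Bialgebra.comul_mul, gG.comul_eq_tmul_self, cX, mul_add,
      Algebra.TensorProduct.tmul_mul_tmul, Algebra.TensorProduct.tmul_mul_tmul, mul_one]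
  obtain ⟨c, hc⟩ | ⟨t, s, ht, hs⟩ := eq_smul_or_exists hij (gG.mul gH) cv
  -- Cancelling `G` would make `x` a multiple of `1 - h`, but the functional dual to `x` vanishes on
  -- `1` and `h`.
  · exfalso
    have h1 : X = c • (1 - H) := by
      rw [← hG] at hc
      have := congrArg (G' * ·) hc
      simpa only [mul_smul_comm, mul_sub, ← mul_assoc, hG2, one_mul] using this
    have h2 : TaftAlgebra.x m q = c • (1 - TaftAlgebra.h m q) :=
      hi (by rw [map_smul, map_sub, map_one]; exact h1)
    have h3 := TaftAlgebra.coeffX_x m q hm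
    rw [h2, map_smul, map_sub, TaftAlgebra.coeffX_one, TaftAlgebra.coeffX_h, sub_zero,
      smul_zero] at h3
    exact zero_ne_one h3
  · rw [← hG] at ht hs
    -- Thus `t` and `s` represent the conjugates of `H` and `X` by `G`, and inherit their coalgebra
    -- structure and `q`-commutation.
    have hit : i t = G * H * G' := by rw [ht, mul_assoc, hG1, mul_one]
    have his : i s = G * X * G' := by rw [hs, mul_assoc, hG1, mul_one]
    have gt : IsGroupLikeElem K t := by
      have g1 : IsGroupLikeElem K (i t) := hit ▸ (gG.mul gH).mul gG'
      refine ⟨?_, BialgHom.comul_eq_of_injective hi g1.comul_eq_tmul_self⟩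
      rw [← CoalgHomClass.counit_comp_apply i t]
      exact g1.counit_eq_one
    have cs : comul (R := K) s = s ⊗ₜ t + 1 ⊗ₜ s := by
      refine BialgHom.comul_eq_of_injective hi ?_
      rw [map_add, TensorProduct.map_tmul, TensorProduct.map_tmul]
      simp only [AlgHom.toLinearMap_apply, BialgHom.coe_toAlgHom, map_one]
      rw [his, hit, Bialgebra.comul_mul, cv, gG'.comul_eq_tmul_self, add_mul,
        Algebra.TensorProduct.tmul_mul_tmul, Algebra.TensorProduct.tmul_mul_tmul, hG1]
    have hst : s * t = q • (t * s) := by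
      apply hi
      rw [map_mul, map_smul, map_mul, his, hit]
      calc G * X * G' * (G * H * G') = G * X * (G' * G) * H * G' := by simp only [mul_assoc]
        _ = G * (X * H) * G' := by rw [hG2, mul_one, mul_assoc G]
        _ = q • (G * H * 1 * X * G') := by
          rw [hXH, mul_smul_comm, smul_mul_assoc, mul_one, mul_assoc G H]
        _ = q • (G * H * G' * (G * X * G')) := by rw [← hG2]; simp only [mul_assoc]
    have hs0 : s ≠ 0 := by
      rintro rfl
      rw [map_zero, zero_mul] at hs
      exact hX0 (by rw [← one_mul X, ← hG2, mul_assoc, hs, mul_zero])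
    obtain ⟨rfl, ω, rfl⟩ := TaftAlgebra.eq_h_and_eq_smul_x m q hm gt cs hst hs0
    have hGX : G * X = ω • (X * G) := by rw [hs, map_smul, smul_mul_assoc]
    refine ⟨ω, ?_, ht.symm, hGX⟩
    -- At `k = n`, where `G ^ n = 1`, this reads `X = ω ^ n • X`, and `X ≠ 0` gives `ω ^ n = 1`.
    have hpow : ∀ k : ℕ, G ^ k * X = ω ^ k • (X * G ^ k) := by
      intro k
      induction k with
      | zero => simp
      | succ k ih =>
        rw [pow_succ, mul_assoc, hGX, mul_smul_comm, ← mul_assoc, ih, smul_mul_assoc, smul_smul,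
          mul_assoc, ← pow_succ, ← pow_succ']
    have h1 := hpow n
    rw [hGn, one_mul, mul_one, ← sub_eq_zero, ← one_smul K X, smul_smul, mul_one, ← sub_smul,
      smul_eq_zero] at h1
    exact (sub_eq_zero.1 (h1.resolve_right hX0)).symm

/-- The map from `T^ω` given by the presentation carries the product map of `T^ω` to that of `E`.
Both are bijective, so the map is too, with no dimension count. -/
lemma TaftFactorization.nonempty_equiv {K E : Type*} [Field K] [Ring E] [HopfAlgebra K E]
    {n m : ℕ} [NeZero n] [NeZero m] {q ω : K} [Fact (IsPrimitiveRoot q m)]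
    {i : TaftAlgebra m q →ₐc[K] E} {j : MonoidAlgebra K (Multiplicative (ZMod n)) →ₐc[K] E}
    (hij : Function.Bijective (factorMap i j)) (hω : ω ^ n = 1)
    (hhg : i (TaftAlgebra.h m q) * j (cyclicGen K n) =
      j (cyclicGen K n) * i (TaftAlgebra.h m q))
    (hgx : j (cyclicGen K n) * i (TaftAlgebra.x m q) =
        ω • (i (TaftAlgebra.x m q) * j (cyclicGen K n))) :
    Nonempty (E ≃ₐc[K] ExtTaftAlgebra n m q ω) := by
  let ψ : ExtTaftAlgebra n m q ω →ₐ[K] E :=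
    ExtTaftAlgebra.lift (j (cyclicGen K n)) (i (TaftAlgebra.h m q)) (i (TaftAlgebra.x m q))
      (by rw [← map_pow, cyclicGen_pow_self, map_one])
      (by rw [← map_pow, TaftAlgebra.h_pow, map_one])
      (by rw [← map_pow, TaftAlgebra.x_pow, map_zero])
      (by rw [← map_mul, TaftAlgebra.x_mul_h, map_smul, map_mul]) hhg hgx
  have ψg : ψ (ExtTaftAlgebra.g n m q ω) = j (cyclicGen K n) := ExtTaftAlgebra.lift_g ..
  have ψh : ψ (ExtTaftAlgebra.h n m q ω) = i (TaftAlgebra.h m q) := ExtTaftAlgebra.lift_h ..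
  have ψx : ψ (ExtTaftAlgebra.x n m q ω) = i (TaftAlgebra.x m q) := ExtTaftAlgebra.lift_x ..
  let Ψ : ExtTaftAlgebra n m q ω →ₐc[K] E := .ofAlgHom ψ
    (by
      apply ExtTaftAlgebra.algHom_ext <;>
        simp [ψg, ψh, ψx, counit_cyclicGen])
    (by
      apply ExtTaftAlgebra.algHom_ext
      · simp [ψg, ← CoalgHomClass.map_comp_comul_apply, comul_cyclicGen]
      · simp [ψh, ← CoalgHomClass.map_comp_comul_apply]
      · simp [ψh, ψx, ← CoalgHomClass.map_comp_comul_apply])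
  have hi : ∀ a, ψ (ExtTaftAlgebra.ofTaft n m q ω a) = i a := by
    have : ψ.comp (ExtTaftAlgebra.ofTaft n m q ω : TaftAlgebra m q →ₐ[K] _) =
        (i : TaftAlgebra m q →ₐ[K] E) :=
      TaftAlgebra.algHom_ext (by simp [ψh]) (by simp [ψx])
    exact fun a => DFunLike.congr_fun this a
  have hj : ∀ y, ψ (ExtTaftAlgebra.ofCyclic n m q ω y) = j y := by
    have : ψ.comp (ExtTaftAlgebra.ofCyclic n m q ω : MonoidAlgebra K _ →ₐ[K] _) =
        (j : MonoidAlgebra K (Multiplicative (ZMod n)) →ₐ[K] E) :=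
      cyclic_algHom_ext (by simp [ψg])
    exact fun y => DFunLike.congr_fun this y
  have hcomp : Ψ ∘ factorMap (ExtTaftAlgebra.ofTaft n m q ω) (ExtTaftAlgebra.ofCyclic n m q ω) =
      factorMap i j := by
    have : ψ.toLinearMap ∘ₗ factorMap (ExtTaftAlgebra.ofTaft n m q ω)
        (ExtTaftAlgebra.ofCyclic n m q ω) = factorMap i j :=
      TensorProduct.ext' fun a y => by simp [hi, hj]
    exact congrArg DFunLike.coe this
  have hbij : Function.Bijective Ψ := by
    rw [← Function.Bijective.of_comp_iff _ (ExtTaftAlgebra.factorMap_bijective n m q ω hω), hcomp]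
    exact hij
  exact ⟨(BialgEquiv.ofBijective Ψ hbij).symm⟩

end

theorem corollary3p2 {K E : Type*} [Field K] [Ring E] [HopfAlgebra K E]
    (n m : ℕ) [NeZero n] [NeZero m] (hn : 2 ≤ n) (hm : 3 ≤ m)
    (q : K) [Fact (IsPrimitiveRoot q m)] :
    FactorizesThrough K E (TaftAlgebra m q) (MonoidAlgebra K (Multiplicative (ZMod n))) ↔
      ∃ ω : K, ω ^ n = 1 ∧ Nonempty (E ≃ₐc[K] ExtTaftAlgebra n m q ω) := by
  constructor
  · rintro ⟨i, j, hi, -, hij⟩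
    obtain ⟨ω, hω, hhg, hgx⟩ := TaftFactorization.exists_relations (by omega) hi hij
    exact ⟨ω, hω, TaftFactorization.nonempty_equiv hij hω hhg hgx⟩
  · rintro ⟨ω, hω, ⟨e⟩⟩
    -- The factorization of `T^ω` is transported along the inverse isomorphism.
    refine factorizesThrough_of_bijective
      ((e.symm : _ →ₐc[K] E).comp (ExtTaftAlgebra.ofTaft n m q ω))
      ((e.symm : _ →ₐc[K] E).comp (ExtTaftAlgebra.ofCyclic n m q ω)) ?_
    have h1 : factorMap ((e.symm : _ →ₐc[K] E).comp (ExtTaftAlgebra.ofTaft n m q ω))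
        ((e.symm : _ →ₐc[K] E).comp (ExtTaftAlgebra.ofCyclic n m q ω)) =
        (e.symm : _ →ₐc[K] E).toCoalgHom.toLinearMap ∘ₗ
          factorMap (ExtTaftAlgebra.ofTaft n m q ω) (ExtTaftAlgebra.ofCyclic n m q ω) :=
      TensorProduct.ext' fun a y => (map_mul e.symm _ _).symm
    rw [h1]
    exact e.symm.bijective.comp (ExtTaftAlgebra.factorMap_bijective n m q ω hω)
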